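/- Conventions. Let $\Lambda=\varprojlim_k\mathbb Z[x_1,\dots,x_k]^{S_k}$ (as graded rings) be the ring of symmetric functions, $h_n$, $p_n$, $s_\lambda$ the complete symmetric functions, power sums and Schur functions. A pre-$\lambda$-ring is a commutative ring $R$ with operations $\sigma_n$ such that $\sigma_t(a)=\sum_n t^n\sigma_n(a)$ satisfies $\sigma_t(a)=1+ta+O(t^2)$ and $\sigma_t(a+b)=\sigma_t(a)\sigma_t(b)$; for $a\in R$, $f\mapsto f\circ a$ is the ring homomorphism $\Lambda\to R$ with $h_n\circ a=\sigma_n(a)$, and $\psi_n(a)=p_n\circ a$. The ring $\Lambda$ is a pre-$\lambda$-ring in which $f\circ g$ is plethysm, and $R$ is a $\lambda$-ring if $f\circ(g\circ x)=(f\circ g)\circ x$ for all $f,g\in\Lambda$, $x\in R$. The completed tensor product $\Lambda\hat\otimes R=\prod_n\Lambda_n\otimes R$ (the ring of symmetric power series over $R$, filtered by degree, with filtration steps $F^n$) carries the pre-$\lambda$-structure for which the variables satisfy $\sigma_n(x_i)=x_i^n$ and which restricts to that of $R$. On $F^1$ put $\mathrm{Exp}(a)=\sum_{n\ge0}\sigma_n(a)$,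 and let $\mathrm{Log}$ be the inverse of $\mathrm{Exp}\colon F^1\to 1+F^1$. For $u$ without constant term and coefficients in a $\mathbb Q$-algebra, $(1+u)^c=\exp(c\log(1+u))$. Theorem. (1) The element $\mathrm{Log}(1+p_1)\in F^1(\Lambda\hat\otimes\mathbb Z)$ exists, that is, $\mathrm{Exp}(\mathrm{Log}(1+p_1))=1+p_1$, and over $\mathbb Q$ it is given by $\mathrm{Log}(1+p_1)=\sum_{n\ge1}\frac{\mu(n)}n\log(1+p_n)$. (2) There are symmetric functions $\varphi_\lambda\in\Lambda$, indexed by all partitions $\lambda$, such that for every $\lambda$-ring $R$ and every $x\in R$ the following holds, with $\Phi_\lambda(x)=\varphi_\lambda\circ x$. (a) The infinite product converges in the degree filtration, and $$\prod_{k=1}^\infty(1+p_k)^{\frac1k\sum_{d\mid k}\mu(k/d)\psi_d(x)}=\mathrm{Exp}\bigl(\mathrm{Log}(1+p_1)\,x\bigr)$$ in $\Lambda\hat\otimes(\mathbb Q\otimes R)$, where the right-hand side is the image of the element $\mathrm{Exp}(\mathrm{Log}(1+p_1)\,x)$ of $\Lambda\hat\otimes R$. (b) In $\Lambda\hat\otimes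 R$ one has $\sum_\lambda s_\lambda\otimes\Phi_\lambda(x)=\mathrm{Exp}(\mathrm{Log}(1+p_1)\,x)$, and the family $(\Phi_\lambda(x))_\lambda$ in $R$ is the only one with this property. (c) The images of the $\Phi_\lambda(x)$ in $\mathbb Q\otimes R$ form the only family $(y_\lambda)$ in $\mathbb Q\otimes R$ for which $\sum_\lambda s_\lambda\otimes y_\lambda$ is the series in (a). Thus the operations $\Phi_\lambda$ defined by the generating function $\Phi(x)=\sum_\lambda s_\lambda\otimes\Phi_\lambda(x)=\prod_k(1+p_k)^{\frac1k\sum_{d\mid k}\mu(k/d)\psi_d(x)}$ are defined, without denominators, on every $\lambda$-ring. -/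

import Mathlib

namespace LambdaRings

open Finset

/-- A pre-`λ`-ring: a commutative ring with operations `σ n` such that
`σ_t(a) = ∑ σ n a t^n` satisfies `σ_t(a) = 1 + t a + O(t²)` and `σ_t(a + b) = σ_t(a) σ_t(b)`. -/
class PreLambdaRing (R : Type*) [CommRing R] where
  σ : ℕ → R → R
  σ_zero : ∀ a, σ 0 a = 1
  σ_one : ∀ a, σ 1 a = a
  σ_add : ∀ n a b, σ n (a + b) = ∑ ij ∈ antidiagonal n, σ ij.1 a * σ ij.2 b

theorem PreLambdaRing.σ_zero_right {R : Type*} [CommRing R] [PreLambdaRing R] {n : ℕ}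
    (hn : n ≠ 0) : PreLambdaRing.σ n (0 : R) = 0 := by
  induction n using Nat.strong_induction_on with
  | _ n ih =>
    have h := PreLambdaRing.σ_add n (0 : R) 0
    obtain ⟨k, rfl⟩ := Nat.exists_eq_succ_of_ne_zero hn
    rw [add_zero, Nat.succ_eq_add_one, Nat.antidiagonal_succ, sum_cons, sum_map] at h
    rw [Nat.sum_antidiagonal_eq_sum_range_succ_mk, sum_range_succ] at h
    simp only [PreLambdaRing.σ_zero, one_mul, Function.Embedding.prodMap,
      Function.Embedding.coeFn_mk, Prod.map, Nat.succ_eq_add_one,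
      Function.Embedding.refl_apply, Nat.sub_self, mul_one] at h
    rw [sum_eq_zero] at h
    · simpa using h
    · intro i hi
      rw [mem_range] at hi
      rw [ih (i + 1) (by omega) (by omega), zero_mul]

/-- `ℤ` is a (pre-)`λ`-ring with `σ_t(c) = (1 - t)^(-c)`. -/
instance : PreLambdaRing ℤ where
  σ n c := (-1) ^ n * Ring.choose (-c) n
  σ_zero a := by simp
  σ_one a := by simp
  σ_add n a b := by
    rw [neg_add, Ring.add_choose_eq n (Commute.all _ _), mul_sum]
    refine sum_congr rfl fun ij hij => ?_
    rw [← mem_antidiagonal.1 hij, pow_add]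
    ring

variable {R : Type*} [CommRing R]

/-- The ring of symmetric power series in countably many variables `x₀, x₁, …` with coefficients
in `R`, that is, the completed tensor product `Λ ⊗̂ R = ∏ₙ Λₙ ⊗ R` of the ring `Λ` of symmetric
functions (filtered by degree) and of `R` (with the discrete filtration); for `R = ℤ` it is the
completion of `Λ`. The tensor `f ⊗ r` is the series `r · f(x₀, x₁, …)`. -/
def SymSeries (R : Type*) [CommRing R] : Subring (MvPowerSeries ℕ R) where
  carrier := {F | ∀ (e : ℕ ≃ ℕ) (m : ℕ →₀ ℕ),
    MvPowerSeries.coeff (m.mapDomain e) F = MvPowerSeries.coeff m F}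
  zero_mem' := by intro e m; simp
  one_mem' := by
    intro e m
    classical
    rw [MvPowerSeries.coeff_one, MvPowerSeries.coeff_one]
    have : m.mapDomain e = 0 ↔ m = 0 := by
      rw [← Finsupp.mapDomain_zero (f := e)]
      exact (Finsupp.mapDomain_injective e.injective).eq_iff
    simp [this]
  add_mem' := by
    intro a b ha hb e m
    rw [map_add, map_add, ha, hb]
  neg_mem' := by
    intro a ha e m
    rw [map_neg, map_neg, ha]
  mul_mem' := by
    intro a b ha hb e m
    classical
    rw [MvPowerSeries.coeff_mul, MvPowerSeries.coeff_mul]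
    symm
    refine sum_equiv ((Finsupp.domCongr e).toEquiv.prodCongr (Finsupp.domCongr e).toEquiv) ?_ ?_
    · rintro ⟨u, v⟩
      have : ∀ w : ℕ →₀ ℕ, (Finsupp.domCongr e) w = w.mapDomain e := fun w => by
        simp [Finsupp.equivMapDomain_eq_mapDomain]
      simp only [HasAntidiagonal.mem_antidiagonal, Equiv.prodCongr_apply, Prod.map, AddEquiv.toEquiv_eq_coe,
        EquivLike.coe_coe, this]
      rw [← Finsupp.mapDomain_add]
      exact (Finsupp.mapDomain_injective e.injective).eq_iff.symm
    · rintro ⟨u, v⟩ _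
      have : ∀ w : ℕ →₀ ℕ, (Finsupp.domCongr e) w = w.mapDomain e := fun w => by
        simp [Finsupp.equivMapDomain_eq_mapDomain]
      simp only [Equiv.prodCongr_apply, Prod.map, AddEquiv.toEquiv_eq_coe,
        EquivLike.coe_coe, this]
      rw [ha, hb]

section sigma
variable [PreLambdaRing R]

/-- The finitely supported families `k` of exponents, indexed by monomials `x^m`, such that
`∑ₘ kₘ = n` and `∏ₘ (x^m)^(kₘ) = x^M`; see `mem_weights`. -/
noncomputable def weights (n : ℕ) (M : ℕ →₀ ℕ) : Finset ((ℕ →₀ ℕ) →₀ ℕ) :=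
  ((Iic M).finsuppAntidiag n).filter fun k => k.sum (fun m j => j • m) = M

theorem mem_weights {n : ℕ} {M : ℕ →₀ ℕ} {k : (ℕ →₀ ℕ) →₀ ℕ} :
    k ∈ weights n M ↔ k.degree = n ∧ k.sum (fun m j => j • m) = M := by
  unfold weights
  rw [mem_filter, mem_finsuppAntidiag]
  constructor
  · rintro ⟨⟨h1, h2⟩, h3⟩
    refine ⟨?_, h3⟩
    rw [Finsupp.degree_apply, ← h1]
    exact sum_subset h2 (fun m _ hm => by simpa using hm)
  · rintro ⟨h1, h3⟩
    have h2 : k.support ⊆ Iic M := by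
      intro m hm
      rw [mem_Iic, ← h3, Finsupp.sum]
      refine le_trans ?_ (single_le_sum (f := fun m => k m • m) (fun _ _ => zero_le) hm)
      exact le_self_nsmul zero_le (by simpa using hm)
    refine ⟨⟨?_, h2⟩, h3⟩
    rw [← h1, Finsupp.degree_apply]
    exact (sum_subset h2 (fun m _ hm => by simpa using hm)).symm

/-- The operation `σₙ` on power series over a pre-`λ`-ring `R`, for the pre-`λ`-structure of
`R[x₀, x₁, …] = ℤ[x₀] ⊗ ℤ[x₁] ⊗ ⋯ ⊗ R` in which `σₙ(x^m) = (x^m)^n`, extended to infinite sums: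
if `F = ∑ₘ cₘ x^m`, then `∑ₙ σₙ(F) t^n = ∏ₘ (∑ⱼ σⱼ(cₘ) t^j x^(j m))`. -/
@[irreducible] noncomputable def sigmaSeries (n : ℕ) (F : MvPowerSeries ℕ R) : MvPowerSeries ℕ R :=
  fun M => ∑ k ∈ weights n M, k.prod fun m j => PreLambdaRing.σ j (MvPowerSeries.coeff m F)

theorem coeff_sigmaSeries (n : ℕ) (F : MvPowerSeries ℕ R) (M : ℕ →₀ ℕ) :
    MvPowerSeries.coeff M (sigmaSeries n F) =
      ∑ k ∈ weights n M, k.prod fun m j => PreLambdaRing.σ j (MvPowerSeries.coeff m F) := by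
  unfold sigmaSeries
  exact MvPowerSeries.coeff_apply _ _

theorem sigmaSeries_mem (n : ℕ) {F : MvPowerSeries ℕ R} (hF : F ∈ SymSeries R) :
    sigmaSeries n F ∈ SymSeries R := by
  intro e M
  rw [coeff_sigmaSeries, coeff_sigmaSeries]
  symm
  have key : ∀ w : ℕ →₀ ℕ, (Finsupp.domCongr (M := ℕ) e) w = w.mapDomain e := fun w => by
    simp [Finsupp.equivMapDomain_eq_mapDomain]
  let E : (ℕ →₀ ℕ) ≃ (ℕ →₀ ℕ) := (Finsupp.domCongr (M := ℕ) e).toEquiv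
  have hE : ∀ w, E w = w.mapDomain e := key
  have hE' : ∀ j w, j • E w = E (j • w) := fun j w => (map_nsmul (Finsupp.domCongr e) j w).symm
  refine sum_equiv (Finsupp.domCongr E).toEquiv ?_ ?_
  · intro k
    rw [mem_weights, mem_weights]
    simp only [AddEquiv.toEquiv_eq_coe, EquivLike.coe_coe, Finsupp.domCongr_apply]
    have h1 : (Finsupp.equivMapDomain E k).degree = k.degree := by
      rw [Finsupp.equivMapDomain_eq_mapDomain, Finsupp.degree_mapDomain]
    have h2 : (Finsupp.equivMapDomain E k).sum (fun m j => j • m) =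
        E (k.sum fun m j => j • m) := by
      rw [Finsupp.sum_equivMapDomain]
      simp only [hE']
      exact (map_finsuppSum (Finsupp.domCongr e) _ _).symm
    rw [h1, h2, ← hE, E.apply_eq_iff_eq]
  · intro k _
    simp only [AddEquiv.toEquiv_eq_coe, EquivLike.coe_coe, Finsupp.domCongr_apply]
    rw [Finsupp.prod_equivMapDomain]
    refine Finsupp.prod_congr fun m _ => ?_
    rw [hE, hF]

/-- The factor `∑ⱼ σⱼ(cₘ) t^j x^(j m)`, as a power series in `t`. -/
noncomputable def genSeries (F : MvPowerSeries ℕ R) (m : ℕ →₀ ℕ) :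
    PowerSeries (MvPowerSeries ℕ R) :=
  PowerSeries.mk fun j =>
    MvPowerSeries.monomial (j • m) (PreLambdaRing.σ j (MvPowerSeries.coeff m F))

theorem coeff_prod_genSeries (F : MvPowerSeries ℕ R) (s : Finset (ℕ →₀ ℕ)) (n : ℕ)
    (M : ℕ →₀ ℕ) (hs : Iic M ⊆ s) :
    MvPowerSeries.coeff M (PowerSeries.coeff n (∏ m ∈ s, genSeries F m)) =
      MvPowerSeries.coeff M (sigmaSeries n F) := by
  classical
  have hprod : ∀ l : (ℕ →₀ ℕ) →₀ ℕ, ∀ t : Finset (ℕ →₀ ℕ),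
      ∏ m ∈ t, PowerSeries.coeff (l m) (genSeries F m) =
        MvPowerSeries.monomial (∑ m ∈ t, l m • m)
          (∏ m ∈ t, PreLambdaRing.σ (l m) (MvPowerSeries.coeff m F)) := by
    intro l t
    induction t using Finset.induction_on with
    | empty => simp
    | insert a t ha ih =>
      rw [prod_insert ha, prod_insert ha, sum_insert ha, ih, genSeries, PowerSeries.coeff_mk,
        MvPowerSeries.monomial_mul_monomial]
  rw [PowerSeries.coeff_prod, map_sum, coeff_sigmaSeries]
  simp_rw [hprod, MvPowerSeries.coeff_monomial]
  rw [← sum_filter]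
  refine sum_congr ?_ ?_
  · ext l
    rw [mem_filter, mem_finsuppAntidiag, mem_weights]
    constructor
    · rintro ⟨⟨h1, h2⟩, h3⟩
      rw [Finsupp.degree_apply, Finsupp.sum]
      constructor
      · rw [← h1]
        exact sum_subset h2 (fun m _ hm => by simpa using hm)
      · rw [h3]
        exact sum_subset h2 (fun m _ hm => by
          rw [Finsupp.notMem_support_iff.1 hm, zero_nsmul])
    · intro h
      have h2 : l.support ⊆ s := by
        have := (mem_weights.2 h)
        unfold weights at this
        rw [mem_filter, mem_finsuppAntidiag] at this
        exact this.1.2.trans hs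
      obtain ⟨h1, h3⟩ := h
      refine ⟨⟨?_, h2⟩, ?_⟩
      · rw [← h1, Finsupp.degree_apply]
        exact (sum_subset h2 (fun m _ hm => by simpa using hm)).symm
      · rw [← h3, Finsupp.sum]
        exact (sum_subset h2 (fun m _ hm => by
          rw [Finsupp.notMem_support_iff.1 hm, zero_nsmul]))
  · intro l hl
    have hl' : l.support ⊆ Iic M := by
      unfold weights at hl
      rw [mem_filter, mem_finsuppAntidiag] at hl
      exact hl.1.2
    rw [Finsupp.prod]
    exact (prod_subset (hl'.trans hs) (fun m _ hm => by
      rw [Finsupp.notMem_support_iff.1 hm, PreLambdaRing.σ_zero])).symm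

theorem genSeries_add (F G : MvPowerSeries ℕ R) (m : ℕ →₀ ℕ) :
    genSeries (F + G) m = genSeries F m * genSeries G m := by
  ext1 n
  rw [PowerSeries.coeff_mul]
  simp only [genSeries, PowerSeries.coeff_mk, MvPowerSeries.monomial_mul_monomial]
  rw [map_add, PreLambdaRing.σ_add, map_sum]
  refine sum_congr rfl fun ij hij => ?_
  rw [← add_nsmul, HasAntidiagonal.mem_antidiagonal.1 hij]

theorem sigmaSeries_add (n : ℕ) (F G : MvPowerSeries ℕ R) :
    sigmaSeries n (F + G) =
      ∑ ij ∈ antidiagonal n, sigmaSeries ij.1 F * sigmaSeries ij.2 G := by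
  classical
  ext M
  rw [← coeff_prod_genSeries _ (Iic M) n M subset_rfl]
  simp_rw [genSeries_add, prod_mul_distrib]
  rw [PowerSeries.coeff_mul, map_sum, map_sum]
  refine sum_congr rfl fun ij _ => ?_
  rw [MvPowerSeries.coeff_mul, MvPowerSeries.coeff_mul]
  refine sum_congr rfl fun ab hab => ?_
  have hab' := HasAntidiagonal.mem_antidiagonal.1 hab
  rw [coeff_prod_genSeries, coeff_prod_genSeries]
  · exact Iic_subset_Iic.2 (hab' ▸ le_add_self)
  · exact Iic_subset_Iic.2 (hab' ▸ le_self_add)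

theorem sigmaSeries_zero (F : MvPowerSeries ℕ R) : sigmaSeries 0 F = 1 := by
  classical
  ext M
  rw [coeff_sigmaSeries, MvPowerSeries.coeff_one]
  have h : weights 0 M = if M = 0 then {0} else ∅ := by
    ext k
    rw [mem_weights, Finsupp.degree_eq_zero_iff]
    split_ifs with hM
    · subst hM
      simp only [mem_singleton, and_iff_left_iff_imp]
      rintro rfl
      simp
    · simp only [notMem_empty, iff_false, not_and]
      rintro rfl
      simpa using Ne.symm hM
  rw [h]
  split_ifs <;> simp

theorem sigmaSeries_one (F : MvPowerSeries ℕ R) : sigmaSeries 1 F = F := by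
  classical
  ext M
  rw [coeff_sigmaSeries]
  have h : weights 1 M = {Finsupp.single M 1} := by
    ext k
    rw [mem_weights, mem_singleton]
    constructor
    · rintro ⟨h1, h2⟩
      obtain ⟨m, rfl⟩ := (Finsupp.sum_eq_one_iff k).1 h1
      rw [Finsupp.sum_single_index (by simp), one_nsmul] at h2
      rw [h2]
    · rintro rfl
      simp
  rw [h, sum_singleton, Finsupp.prod_single_index (PreLambdaRing.σ_zero _),
    PreLambdaRing.σ_one]

/-- The operation `σₙ` on `Λ ⊗̂ R`. -/
noncomputable def SymSeries.sigma (n : ℕ) (F : SymSeries R) : SymSeries R :=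
  ⟨sigmaSeries n F.1, sigmaSeries_mem n F.2⟩

theorem SymSeries.coe_sigma (n : ℕ) (F : SymSeries R) :
    (SymSeries.sigma n F).1 = sigmaSeries n F.1 := rfl

theorem SymSeries.sigma_add (n : ℕ) (F G : SymSeries R) :
    SymSeries.sigma n (F + G) =
      ∑ ij ∈ antidiagonal n, SymSeries.sigma ij.1 F * SymSeries.sigma ij.2 G := by
  refine Subtype.ext ?_
  rw [AddSubmonoidClass.coe_finsetSum, SymSeries.coe_sigma, Subring.coe_add, sigmaSeries_add]
  refine sum_congr rfl fun ij _ => ?_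
  rw [Subring.coe_mul, SymSeries.coe_sigma, SymSeries.coe_sigma]

/-- `Λ ⊗̂ R` is a pre-`λ`-ring. -/
noncomputable instance : PreLambdaRing (SymSeries R) where
  σ := SymSeries.sigma
  σ_zero F := Subtype.ext (sigmaSeries_zero F.1)
  σ_one F := Subtype.ext (sigmaSeries_one F.1)
  σ_add := SymSeries.sigma_add

theorem SymSeries.coe_σ (n : ℕ) (F : SymSeries R) :
    (PreLambdaRing.σ n F).1 = sigmaSeries n F.1 := rfl

end sigma

theorem exists_mapDomain_eq_embDomain (n : ℕ) (m : ℕ →₀ ℕ) (hm : m.degree ≤ n) :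
    ∃ (e : ℕ ≃ ℕ) (u : Fin n →₀ ℕ), m.mapDomain e = u.embDomain Fin.valEmbedding := by
  have hcard : m.support.card ≤ n := by
    refine le_trans ?_ hm
    rw [Finsupp.degree_apply, card_eq_sum_ones]
    exact sum_le_sum fun i hi => Nat.one_le_iff_ne_zero.2 (by simpa using hi)
  let f : (m.support : Set ℕ) ↪ ℕ :=
    ⟨fun i => (m.support.equivFin i : ℕ), fun a b h => by
      simpa [Fin.val_inj] using h⟩
  obtain ⟨e, he⟩ := Cardinal.extend_function_of_lt f
    (lt_of_lt_of_le (Cardinal.lt_aleph0_of_finite _) (by simp)) ⟨Equiv.refl _⟩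
  refine ⟨e, ?_⟩
  have : m.mapDomain e ∈ Set.range (Finsupp.embDomain (M := ℕ) (Fin.valEmbedding (n := n))) := by
    rw [Finsupp.mem_range_embDomain_iff]
    intro i hi
    have hi' := Finsupp.mapDomain_support hi
    rw [mem_image] at hi'
    obtain ⟨j, hj, rfl⟩ := hi'
    have h := he ⟨j, hj⟩
    exact ⟨⟨e j, h ▸ lt_of_lt_of_le (m.support.equivFin ⟨j, hj⟩).2 hcard⟩, rfl⟩
  obtain ⟨u, hu⟩ := this
  exact ⟨u, hu.symm⟩

/-- The ring `Λ` of symmetric functions with integral coefficients: the symmetric power series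
of bounded degree (the inverse limit of the graded rings `ℤ[x₁, …, xₖ]^{Sₖ}`). -/
def SymFun : Subring (SymSeries ℤ) where
  carrier := {f | ∃ d : ℕ, ∀ m : ℕ →₀ ℕ, d < m.degree → MvPowerSeries.coeff m f.1 = 0}
  zero_mem' := ⟨0, fun m _ => by simp⟩
  one_mem' := ⟨0, fun m hm => by
    classical
    have : m ≠ 0 := by rintro rfl; simp at hm
    simp [MvPowerSeries.coeff_one, this]⟩
  add_mem' := by
    rintro a b ⟨d, ha⟩ ⟨d', hb⟩
    refine ⟨max d d', fun m hm => ?_⟩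
    have h1 := ha m (lt_of_le_of_lt (le_max_left _ _) hm)
    have h2 := hb m (lt_of_le_of_lt (le_max_right _ _) hm)
    simp [h1, h2]
  neg_mem' := by
    rintro a ⟨d, ha⟩
    exact ⟨d, fun m hm => by simp [ha m hm]⟩
  mul_mem' := by
    classical
    rintro a b ⟨d, ha⟩ ⟨d', hb⟩
    refine ⟨d + d', fun m hm => ?_⟩
    rw [Subring.coe_mul, MvPowerSeries.coeff_mul]
    refine sum_eq_zero fun uv huv => ?_
    rw [← HasAntidiagonal.mem_antidiagonal.1 huv, map_add] at hm
    rcases lt_or_ge d uv.1.degree with h | h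
    · rw [ha _ h, zero_mul]
    · rw [hb _ (by omega), mul_zero]

theorem sigma_mem_symFun (n : ℕ) {f : SymSeries ℤ} (hf : f ∈ SymFun) :
    PreLambdaRing.σ n f ∈ SymFun := by
  obtain ⟨d, hd⟩ := hf
  refine ⟨n * d, fun M hM => ?_⟩
  rw [SymSeries.coe_σ, coeff_sigmaSeries]
  refine sum_eq_zero fun k hk => ?_
  rw [mem_weights] at hk
  by_contra hne
  have hk' : ∀ m ∈ k.support, m.degree ≤ d := by
    intro m hm
    by_contra hlt
    refine hne (prod_eq_zero hm ?_)
    simp only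
    rw [hd m (not_le.1 hlt), PreLambdaRing.σ_zero_right (by simpa using hm)]
  refine absurd hM (not_lt.2 ?_)
  rw [← hk.2, ← hk.1, Finsupp.sum, map_sum, Finsupp.degree_apply, sum_mul]
  refine sum_le_sum fun m hm => ?_
  rw [map_nsmul, smul_eq_mul]
  exact Nat.mul_le_mul_left _ (hk' m hm)

/-- The operation `σₙ` on `Λ`. -/
noncomputable def SymFun.sigma (n : ℕ) (f : SymFun) : SymFun :=
  ⟨PreLambdaRing.σ n f.1, sigma_mem_symFun n f.2⟩

theorem SymFun.coe_sigma (n : ℕ) (f : SymFun) :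
    (SymFun.sigma n f).1 = PreLambdaRing.σ n f.1 := rfl

theorem SymFun.sigma_add (n : ℕ) (f g : SymFun) :
    SymFun.sigma n (f + g) =
      ∑ ij ∈ antidiagonal n, SymFun.sigma ij.1 f * SymFun.sigma ij.2 g := by
  refine Subtype.ext ?_
  rw [AddSubmonoidClass.coe_finsetSum, SymFun.coe_sigma, Subring.coe_add, PreLambdaRing.σ_add]
  refine sum_congr rfl fun ij _ => ?_
  rw [Subring.coe_mul, SymFun.coe_sigma, SymFun.coe_sigma]

/-- The pre-`λ`-ring structure of `Λ`, restricted from `ℤ[x₀, x₁, …]`: if `f = ∑ₘ cₘ x^m`, then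
`∑ₙ σₙ(f) t^n = ∏ₘ (1 - t x^m)^(-cₘ)`. -/
noncomputable instance : PreLambdaRing SymFun where
  σ := SymFun.sigma
  σ_zero f := Subtype.ext (PreLambdaRing.σ_zero f.1)
  σ_one f := Subtype.ext (PreLambdaRing.σ_one f.1)
  σ_add := SymFun.sigma_add

/-- The coefficient of `x^m` in a symmetric function. -/
noncomputable abbrev cf (m : ℕ →₀ ℕ) (f : SymFun) : ℤ := MvPowerSeries.coeff m f.1.1

/-- The symmetric function with given coefficients. -/
def SymFun.ofCoeff (c : (ℕ →₀ ℕ) → ℤ) (n : ℕ) (hc : ∀ (e : ℕ ≃ ℕ) m, c (m.mapDomain e) = c m)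
    (hn : ∀ m, c m ≠ 0 → m.degree ≤ n) : SymFun :=
  ⟨⟨c, hc⟩, ⟨n, fun m hm => not_not.1 fun h => absurd hm (not_lt.2 (hn m h))⟩⟩

/-- The complete symmetric function `hₙ`. -/
noncomputable def hSymm (n : ℕ) : SymFun :=
  SymFun.ofCoeff (fun m => if m.degree = n then 1 else 0) n
    (fun e m => by simp only [Finsupp.degree_mapDomain])
    (fun m hm => by
      by_contra hlt
      exact hm (if_neg (by omega)))

theorem cf_hSymm (n : ℕ) (m : ℕ →₀ ℕ) : cf m (hSymm n) = if m.degree = n then 1 else 0 := rfl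

open Classical in
/-- The elementary symmetric function `eₙ`. -/
noncomputable def eSymm (n : ℕ) : SymFun :=
  SymFun.ofCoeff (fun m => if m.degree = n ∧ ∀ i, m i ≤ 1 then 1 else 0) n
    (fun π m => by
      have : (∀ i, (m.mapDomain π) i ≤ 1) ↔ ∀ i, m i ≤ 1 := by
        rw [← π.forall_congr_right]
        simp only [Finsupp.mapDomain_apply π.injective]
      simp only [Finsupp.degree_mapDomain, this])
    (fun m hm => by
      by_contra hlt
      exact hm (if_neg (by omega)))

open Classical in
theorem cf_eSymm (n : ℕ) (m : ℕ →₀ ℕ) :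
    cf m (eSymm n) = if m.degree = n ∧ ∀ i, m i ≤ 1 then 1 else 0 := rfl

theorem cf_ext {f g : SymFun} (hfg : ∀ m, cf m f = cf m g) : f = g :=
  Subtype.ext (Subtype.ext (MvPowerSeries.ext hfg))

open Classical in
theorem cf_one (m : ℕ →₀ ℕ) : cf m 1 = if m = 0 then 1 else 0 := MvPowerSeries.coeff_one _

theorem cf_mul (m : ℕ →₀ ℕ) (f g : SymFun) :
    cf m (f * g) = ∑ ab ∈ antidiagonal m, cf ab.1 f * cf ab.2 g := by
  classical
  exact MvPowerSeries.coeff_mul _ _ _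

/-- The coefficient of `x^m` as an additive map. -/
noncomputable def cfHom (m : ℕ →₀ ℕ) : SymFun →+ ℤ where
  toFun := cf m
  map_zero' := map_zero _
  map_add' f g := map_add (MvPowerSeries.coeff m) f.1.1 g.1.1

theorem eSymm_zero : eSymm 0 = 1 := by
  classical
  refine cf_ext fun m => ?_
  rw [cf_eSymm, cf_one]
  congr 1
  rw [Finsupp.degree_eq_zero_iff]
  simp only [eq_iff_iff, and_iff_left_iff_imp]
  rintro rfl
  simp

theorem hSymm_zero : hSymm 0 = 1 := by
  classical
  refine cf_ext fun m => ?_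
  rw [cf_hSymm, cf_one]
  simp [Finsupp.degree_eq_zero_iff]

theorem sum_eSymm_mul_hSymm (N : ℕ) (hN : N ≠ 0) :
    ∑ ij ∈ antidiagonal N, (-1 : ℤ) ^ ij.1 • (eSymm ij.1 * hSymm ij.2) = 0 := by
  classical
  refine cf_ext fun m => ?_
  change cfHom m _ = cfHom m 0
  rw [map_sum, map_zero]
  have h1 : ∀ ij ∈ antidiagonal N,
      cfHom m ((-1 : ℤ) ^ ij.1 • (eSymm ij.1 * hSymm ij.2)) =
      ∑ ab ∈ antidiagonal m, if ij = (ab.1.degree, ab.2.degree) then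
        (if ∀ i, ab.1 i ≤ 1 then (-1 : ℤ) ^ ab.1.degree else 0) else 0 := by
    rintro ⟨i, j⟩ _
    rw [map_zsmul]
    change (-1 : ℤ) ^ i • cf m (eSymm i * hSymm j) = _
    rw [cf_mul, smul_sum]
    refine sum_congr rfl fun ab _ => ?_
    rw [cf_eSymm, cf_hSymm]
    simp only [Prod.mk.injEq]
    by_cases ha : i = ab.1.degree
    · subst ha
      by_cases hb : j = ab.2.degree <;> by_cases hc : ∀ i, ab.1 i ≤ 1 <;>
        simp [hb, hc, eq_comm]
    · have h1 : ¬ (i = ab.1.degree ∧ j = ab.2.degree) := fun h => ha h.1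
      have h2 : ¬ (ab.1.degree = i ∧ ∀ i, ab.1 i ≤ 1) := fun h => ha h.1.symm
      simp only [h1, h2, if_false, zero_mul, smul_zero]
  rw [sum_congr rfl h1, sum_comm]
  have h2 : ∀ ab ∈ antidiagonal m, (∑ ij ∈ antidiagonal N,
      if ij = (ab.1.degree, ab.2.degree) then
        (if ∀ i, ab.1 i ≤ 1 then (-1 : ℤ) ^ ab.1.degree else 0) else 0) =
      if m.degree = N then (if ∀ i, ab.1 i ≤ 1 then (-1 : ℤ) ^ ab.1.degree else 0) else 0 := by
    intro ab hab
    rw [sum_ite_eq']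
    congr 1
    rw [HasAntidiagonal.mem_antidiagonal, ← map_add, HasAntidiagonal.mem_antidiagonal.1 hab]
  rw [sum_congr rfl h2]
  by_cases hm : m.degree = N
  swap
  · simp [hm]
  simp only [hm, if_true]
  rw [← sum_filter]
  have hne : m.support.Nonempty := by
    rw [Finsupp.support_nonempty_iff]
    rintro rfl
    simp at hm
    omega
  rw [← sum_powerset_neg_one_pow_card_of_nonempty hne]
  refine sum_bij' (fun ab _ => ab.1.support)
    (fun S _ => (Finsupp.indicator S (fun _ _ => 1), m - Finsupp.indicator S (fun _ _ => 1)))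
    ?_ ?_ ?_ ?_ ?_
  · intro ab hab
    rw [mem_filter, HasAntidiagonal.mem_antidiagonal] at hab
    rw [mem_powerset, ← hab.1]
    exact Finsupp.support_mono le_self_add
  · intro S hS
    rw [mem_powerset] at hS
    rw [mem_filter, HasAntidiagonal.mem_antidiagonal]
    constructor
    · refine add_tsub_cancel_of_le fun i => ?_
      rw [Finsupp.indicator_apply]
      split_ifs with hi
      · exact Nat.one_le_iff_ne_zero.2 (by simpa using hS hi)
      · exact zero_le
    · intro i
      simp only [Finsupp.indicator_apply]
      split_ifs <;> simp
  · rintro ⟨a, b⟩ hab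
    rw [mem_filter, HasAntidiagonal.mem_antidiagonal] at hab
    have ha : Finsupp.indicator a.support (fun _ _ => 1) = a := by
      ext i
      have := hab.2 i
      simp only at this
      rw [Finsupp.indicator_apply]
      split_ifs with hi
      · rw [Finsupp.mem_support_iff] at hi
        omega
      · exact (Finsupp.notMem_support_iff.1 hi).symm
    simp only [ha, Prod.mk.injEq, true_and]
    rw [← hab.1]
    simp
  · intro S hS
    ext i
    simp [Finsupp.indicator_apply]
  · intro ab hab
    rw [mem_filter, HasAntidiagonal.mem_antidiagonal] at hab
    congr 1
    rw [Finsupp.degree_apply, card_eq_sum_ones]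
    refine sum_congr rfl fun i hi => ?_
    have := hab.2 i
    rw [Finsupp.mem_support_iff] at hi
    omega

/-- The evaluation of polynomials at `h₁, h₂, …` (the variable `X i` goes to `h_{i+1}`). -/
noncomputable def polyH : MvPolynomial ℕ ℤ →ₐ[ℤ] SymFun :=
  MvPolynomial.aeval fun i => hSymm (i + 1)

/-- The evaluation of polynomials at `e₁, e₂, …` (the variable `X i` goes to `e_{i+1}`). -/
noncomputable def polyE : MvPolynomial ℕ ℤ →ₐ[ℤ] SymFun :=
  MvPolynomial.aeval fun i => eSymm (i + 1)

/-- The polynomial that expresses `eₙ` through `h₁, h₂, …`. -/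
noncomputable def elemInComplete : ℕ → MvPolynomial ℕ ℤ
  | 0 => 1
  | n + 1 => ∑ i : Fin (n + 1), (-1 : ℤ) ^ (n - i) • (elemInComplete i * MvPolynomial.X (n - i))

theorem elemInComplete_spec (u v : ℕ → SymFun) (hu : u 0 = 1) (hv : v 0 = 1)
    (huv : ∀ N, N ≠ 0 → ∑ ij ∈ antidiagonal N, (-1 : ℤ) ^ ij.2 • (u ij.1 * v ij.2) = 0) (n : ℕ) :
    MvPolynomial.aeval (fun i => v (i + 1)) (elemInComplete n) = u n := by
  induction n using Nat.strong_induction_on with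
  | _ n ih =>
    cases n with
    | zero => rw [elemInComplete, map_one, hu]
    | succ n =>
      have h := huv (n + 1) (by omega)
      rw [Nat.sum_antidiagonal_eq_sum_range_succ_mk, sum_range_succ] at h
      simp only [Nat.sub_self, pow_zero, one_smul, hv, mul_one] at h
      rw [← neg_eq_iff_add_eq_zero] at h
      rw [← h, elemInComplete, map_sum, ← sum_neg_distrib, Fin.sum_univ_eq_sum_range
        (fun i => MvPolynomial.aeval (fun i => v (i + 1))
          ((-1 : ℤ) ^ (n - i) • (elemInComplete i * MvPolynomial.X (n - i))))]
      refine sum_congr rfl fun i hi => ?_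
      rw [mem_range] at hi
      rw [map_zsmul, map_mul, ih i hi, MvPolynomial.aeval_X, ← neg_smul,
        show n - i + 1 = n + 1 - i by omega]
      congr 1
      rw [show n + 1 - i = n - i + 1 by omega, pow_succ]
      ring

theorem polyH_elemInComplete (n : ℕ) : polyH (elemInComplete n) = eSymm n := by
  refine elemInComplete_spec eSymm hSymm eSymm_zero hSymm_zero (fun N hN => ?_) n
  have h := congrArg ((-1 : ℤ) ^ N • ·) (sum_eSymm_mul_hSymm N hN)
  simp only [smul_sum, smul_zero] at h
  rw [← h]
  refine sum_congr rfl fun ij hij => ?_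
  rw [smul_smul, ← HasAntidiagonal.mem_antidiagonal.1 hij]
  congr 1
  rw [pow_add, mul_right_comm, ← mul_pow]
  simp

theorem polyE_elemInComplete (n : ℕ) : polyE (elemInComplete n) = hSymm n := by
  refine elemInComplete_spec hSymm eSymm hSymm_zero eSymm_zero (fun N hN => ?_) n
  rw [← sum_eSymm_mul_hSymm N hN, ← Finset.Nat.sum_antidiagonal_swap]
  refine sum_congr rfl fun ij hij => ?_
  simp [mul_comm]

/-- Setting the variables `xᵢ`, `i ≥ n`, to zero. -/
noncomputable def restrictVars (n : ℕ) : SymFun →+* MvPowerSeries (Fin n) ℤ :=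
  (MvPowerSeries.killCompl (R := ℤ) (Fin.valEmbedding (n := n))).toRingHom.comp
    ((SymSeries ℤ).subtype.comp SymFun.subtype)

theorem coeff_restrictVars (n : ℕ) (f : SymFun) (u : Fin n →₀ ℕ) :
    MvPowerSeries.coeff u (restrictVars n f) = cf (u.embDomain Fin.valEmbedding) f :=
  MvPowerSeries.coeff_killCompl _ _

theorem restrictVars_inj (n : ℕ) (f g : SymFun) (hf : ∀ m, n < m.degree → cf m f = 0)
    (hg : ∀ m, n < m.degree → cf m g = 0)
    (hfg : ∀ u, u.degree ≤ n → MvPowerSeries.coeff u (restrictVars n f) = MvPowerSeries.coeff u (restrictVars n g)) :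
    f = g := by
  refine cf_ext fun m => ?_
  rcases lt_or_ge n m.degree with hm | hm
  · rw [hf m hm, hg m hm]
  · obtain ⟨e, u, hu⟩ := exists_mapDomain_eq_embDomain n m hm
    have h1 : cf (m.mapDomain e) f = cf m f := f.1.2 e m
    have h2 : cf (m.mapDomain e) g = cf m g := g.1.2 e m
    rw [← h1, ← h2, hu, ← coeff_restrictVars, ← coeff_restrictVars]
    refine hfg u ?_
    rw [← Finsupp.degree_mapDomain (Fin.valEmbedding (n := n)), ← Finsupp.embDomain_eq_mapDomain,
      ← hu, Finsupp.degree_mapDomain]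
    exact hm

theorem restrictVars_eSymm (n k : ℕ) : restrictVars n (eSymm k) = (MvPolynomial.esymm (Fin n) ℤ k :) := by
  classical
  ext u
  rw [coeff_restrictVars, cf_eSymm, MvPolynomial.coeff_coe, MvPolynomial.esymm_eq_sum_monomial,
    MvPolynomial.coeff_sum]
  simp only [MvPolynomial.coeff_monomial]
  have hsum : ∀ t : Finset (Fin n), ∀ i,
      (∑ i ∈ t, Finsupp.single i 1 : Fin n →₀ ℕ) i = if i ∈ t then 1 else 0 := by
    intro t i
    rw [Finsupp.finsetSum_apply]
    simp [Finsupp.single_apply]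
  have h1 : (u.embDomain (Fin.valEmbedding (n := n))).degree = u.degree := by
    rw [Finsupp.embDomain_eq_mapDomain, Finsupp.degree_mapDomain]
  have h2 : (∀ i, (u.embDomain (Fin.valEmbedding (n := n))) i ≤ 1) ↔ ∀ i, u i ≤ 1 := by
    constructor
    · intro h i
      have := h (Fin.valEmbedding i)
      rwa [Finsupp.embDomain_apply_self] at this
    · intro h i
      by_cases hi : i ∈ Set.range (Fin.valEmbedding (n := n))
      · obtain ⟨j, rfl⟩ := hi
        rw [Finsupp.embDomain_apply_self]
        exact h j
      · rw [Finsupp.embDomain_of_notMem_range _ _ _ hi]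
        exact zero_le
  rw [h1, h2]
  by_cases hu : ∀ i, u i ≤ 1
  · have hus : ∀ t : Finset (Fin n), (∑ i ∈ t, Finsupp.single i 1 : Fin n →₀ ℕ) = u ↔
        t = u.support := by
      intro t
      constructor
      · rintro rfl
        ext i
        rw [Finsupp.mem_support_iff, hsum]
        simp
      · rintro rfl
        ext i
        rw [hsum]
        have := hu i
        simp only [Finsupp.mem_support_iff]
        split_ifs <;> omega
    simp only [hus, sum_ite_eq', mem_powersetCard, subset_univ, true_and]
    have hc : u.degree = u.support.card := by
      rw [Finsupp.degree_apply, card_eq_sum_ones]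
      refine sum_congr rfl fun i hi => ?_
      have := hu i
      rw [Finsupp.mem_support_iff] at hi
      omega
    simp [hc, hu]
  · rw [if_neg (fun h => hu h.2)]
    symm
    refine sum_eq_zero fun t _ => if_neg ?_
    rintro rfl
    refine hu fun i => ?_
    rw [hsum]
    split_ifs <;> simp

theorem restrictVars_polyE (n : ℕ) (Q : MvPolynomial (Fin n) ℤ) :
    restrictVars n (polyE (MvPolynomial.rename Fin.val Q)) =
      ((MvPolynomial.esymmAlgHom (Fin n) ℤ n Q).val : MvPolynomial (Fin n) ℤ) := by
  rw [MvPolynomial.esymmAlgHom_apply, polyE, MvPolynomial.aeval_rename]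
  induction Q using MvPolynomial.induction_on with
  | C a =>
    simp
    exact (map_intCast (MvPolynomial.coeToMvPowerSeries.ringHom (σ := Fin n) (R := ℤ)) a).symm
  | add p q hp hq => simp only [map_add, hp, hq, MvPolynomial.coe_add]
  | mul_X p i hp =>
    rw [map_mul, map_mul, map_mul, hp, MvPolynomial.aeval_X, MvPolynomial.aeval_X,
      MvPolynomial.coe_mul, Function.comp_apply, restrictVars_eSymm]

theorem polyE_injective : Function.Injective polyE := by
  rw [injective_iff_map_eq_zero]
  intro P hP
  obtain ⟨n, hn⟩ : ∃ n, (P.vars : Set ℕ) ⊆ Set.range (Fin.val : Fin n → ℕ) := by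
    refine ⟨P.vars.sup id + 1, fun i hi => ?_⟩
    have : i ≤ P.vars.sup id := le_sup (f := id) (mem_coe.1 hi)
    exact ⟨⟨i, by omega⟩, rfl⟩
  obtain ⟨Q, rfl⟩ := MvPolynomial.exists_rename_eq_of_vars_subset_range P Fin.val
    Fin.val_injective hn
  have h := restrictVars_polyE n Q
  rw [hP, map_zero] at h
  have h' : (MvPolynomial.esymmAlgHom (Fin n) ℤ n Q).val = 0 :=
    MvPolynomial.coe_injective _ _ (by simpa using h.symm)
  have h'' : Q = 0 := (MvPolynomial.esymmAlgHom_fin_bijective ℤ n).1 (by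
    rw [map_zero]; exact Subtype.ext h')
  rw [h'', map_zero]

/-- Homogeneous of degree `d`. -/
def IsHomog (d : ℕ) (f : SymFun) : Prop := ∀ m, cf m f ≠ 0 → m.degree = d

theorem IsHomog.one : IsHomog 0 1 := by
  classical
  intro m hm
  rw [cf_one] at hm
  have : m = 0 := by by_contra h; exact hm (if_neg h)
  simp [this]

theorem IsHomog.mul {d d' : ℕ} {f g : SymFun} (hf : IsHomog d f) (hg : IsHomog d' g) :
    IsHomog (d + d') (f * g) := by
  classical
  intro m hm
  rw [cf_mul] at hm
  obtain ⟨ab, hab, hne⟩ := exists_ne_zero_of_sum_ne_zero hm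
  rw [← HasAntidiagonal.mem_antidiagonal.1 hab, map_add, hf _ (left_ne_zero_of_mul hne),
    hg _ (right_ne_zero_of_mul hne)]

theorem IsHomog.pow {d : ℕ} {f : SymFun} (hf : IsHomog d f) (k : ℕ) :
    IsHomog (k * d) (f ^ k) := by
  induction k with
  | zero => simpa using IsHomog.one
  | succ k ih =>
    rw [pow_succ, Nat.succ_mul]
    exact ih.mul hf

theorem IsHomog.prod {ι : Type*} (s : Finset ι) (d : ι → ℕ) (f : ι → SymFun)
    (hf : ∀ i, IsHomog (d i) (f i)) : IsHomog (∑ i ∈ s, d i) (∏ i ∈ s, f i) := by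
  classical
  induction s using Finset.induction_on with
  | empty => simpa using IsHomog.one
  | insert a s ha ih =>
    rw [sum_insert ha, prod_insert ha]
    exact (hf a).mul ih

theorem isHomog_eSymm (n : ℕ) : IsHomog n (eSymm n) := by
  classical
  intro m hm
  rw [cf_eSymm] at hm
  by_contra h
  exact hm (if_neg fun h' => h h'.1)

theorem isHomog_polyE {n : ℕ} (t : Fin n →₀ ℕ) (c : ℤ) :
    IsHomog (∑ i ∈ t.support, t i * (i + 1))
      (polyE (MvPolynomial.rename Fin.val (MvPolynomial.monomial t c))) := by
  rw [polyE, MvPolynomial.aeval_rename, MvPolynomial.aeval_monomial, Finsupp.prod]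
  have h := IsHomog.prod t.support (fun i => t i * (i + 1))
    (fun i => eSymm (i + 1) ^ t i) (fun i => (isHomog_eSymm _).pow _)
  intro m hm
  refine h m fun h0 => hm ?_
  rw [← Algebra.smul_def]
  change cfHom m (c • _) = 0
  rw [map_zsmul]
  exact (congrArg (c • ·) h0).trans (smul_zero c)

theorem exists_poly_restrictVars (n : ℕ) (f : SymFun) (hf : ∀ m, n < m.degree → cf m f = 0) :
    ∃ q ∈ MvPolynomial.symmetricSubalgebra (Fin n) ℤ,
      (q : MvPowerSeries (Fin n) ℤ) = restrictVars n f := by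
  classical
  have hfin : {u : Fin n →₀ ℕ | MvPowerSeries.coeff u (restrictVars n f) ≠ 0}.Finite := by
    refine ((Finset.range (n + 1)).biUnion fun j =>
      (univ : Finset (Fin n)).finsuppAntidiag j).finite_toSet.subset fun u hu => ?_
    rw [mem_coe, mem_biUnion]
    refine ⟨u.degree, ?_, by
      rw [mem_finsuppAntidiag]
      exact ⟨(Finsupp.degree_eq_sum u).symm, subset_univ _⟩⟩
    rw [mem_range]
    by_contra hlt
    refine hu ?_
    rw [coeff_restrictVars]
    refine hf _ ?_
    rw [Finsupp.embDomain_eq_mapDomain, Finsupp.degree_mapDomain]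
    omega
  let q : MvPolynomial (Fin n) ℤ :=
    ∑ u ∈ hfin.toFinset, MvPolynomial.monomial u (MvPowerSeries.coeff u (restrictVars n f))
  have hq : ∀ u, MvPolynomial.coeff u q = MvPowerSeries.coeff u (restrictVars n f) := by
    intro u
    rw [MvPolynomial.coeff_sum]
    simp only [MvPolynomial.coeff_monomial, sum_ite_eq', Set.Finite.mem_toFinset,
      Set.mem_ofPred_eq]
    by_cases h : MvPowerSeries.coeff u (restrictVars n f) = 0 <;> simp [h]
  refine ⟨q, ?_, ?_⟩
  · rw [MvPolynomial.mem_symmetricSubalgebra]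
    intro π
    ext u
    obtain ⟨v, rfl⟩ : ∃ v, v.mapDomain π = u := ⟨u.mapDomain π.symm, by
      rw [← Finsupp.mapDomain_comp]; simp⟩
    rw [MvPolynomial.coeff_rename_mapDomain _ π.injective, hq, hq, coeff_restrictVars, coeff_restrictVars]
    have h : cf ((v.embDomain Fin.valEmbedding).mapDomain
        (π.viaEmbedding (Fin.valEmbedding (n := n)))) f =
        cf (v.embDomain (Fin.valEmbedding (n := n))) f := f.1.2 _ _
    rw [← h]
    congr 1
    rw [Finsupp.embDomain_eq_mapDomain, Finsupp.embDomain_eq_mapDomain,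
      ← Finsupp.mapDomain_comp, ← Finsupp.mapDomain_comp]
    congr 1
    funext i
    exact Equiv.Perm.viaEmbedding_apply π Fin.valEmbedding i
  · ext u
    rw [MvPolynomial.coeff_coe, hq]

theorem polyE_surjective : Function.Surjective polyE := by
  classical
  intro f
  obtain ⟨n, hn⟩ := f.2
  obtain ⟨q, hqs, hq⟩ := exists_poly_restrictVars n f hn
  obtain ⟨Q, hQ⟩ := (MvPolynomial.esymmAlgHom_fin_bijective ℤ n).2 ⟨q, hqs⟩
  let w : (Fin n →₀ ℕ) → ℕ := fun t => ∑ i ∈ t.support, t i * (i + 1)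
  let part : (Fin n →₀ ℕ) → SymFun := fun t =>
    polyE (MvPolynomial.rename Fin.val (MvPolynomial.monomial t (MvPolynomial.coeff t Q)))
  have hpart : ∀ t m, m.degree ≠ w t → cfHom m (part t) = 0 := fun t m hm => by
    by_contra h
    exact hm (isHomog_polyE t _ m h)
  have htot : restrictVars n (∑ t ∈ Q.support, part t) = restrictVars n f := by
    rw [← hq, ← show ((MvPolynomial.esymmAlgHom (Fin n) ℤ n Q).val) = q by rw [hQ],
      ← restrictVars_polyE]
    conv_rhs => rw [Q.as_sum]
    simp only [map_sum, part]
  refine ⟨∑ t ∈ Q.support.filter (fun t => w t ≤ n),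
    MvPolynomial.rename Fin.val (MvPolynomial.monomial t (MvPolynomial.coeff t Q)), ?_⟩
  rw [map_sum]
  change ∑ t ∈ Q.support.filter (fun t => w t ≤ n), part t = f
  refine restrictVars_inj n _ f (fun m hm => ?_) hn (fun u hu => ?_)
  · change cfHom m _ = 0
    rw [map_sum]
    refine sum_eq_zero fun t ht => hpart t m ?_
    rw [mem_filter] at ht
    omega
  · rw [← htot, coeff_restrictVars, coeff_restrictVars]
    change cfHom _ _ = cfHom _ _
    rw [map_sum, map_sum]
    refine sum_subset (filter_subset _ _) fun t ht hnt => hpart t _ ?_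
    rw [mem_filter, not_and] at hnt
    have := hnt ht
    rw [Finsupp.embDomain_eq_mapDomain, Finsupp.degree_mapDomain]
    omega

/-- `Λ` is the polynomial ring in `h₁, h₂, …`. -/
theorem polyH_bijective : Function.Bijective polyH := by
  let α : MvPolynomial ℕ ℤ →ₐ[ℤ] MvPolynomial ℕ ℤ := MvPolynomial.aeval fun i => elemInComplete (i + 1)
  have h1 : polyH.comp α = polyE := by
    ext i : 1
    simp only [α, AlgHom.comp_apply, MvPolynomial.aeval_X, polyH_elemInComplete]
    simp [polyE]
  have h2 : polyE.comp α = polyH := by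
    ext i : 1
    simp only [α, AlgHom.comp_apply, MvPolynomial.aeval_X, polyE_elemInComplete]
    simp [polyH]
  have h3 : ∀ P, α (α P) = P := fun P => polyE_injective (by
    rw [← AlgHom.comp_apply polyE, h2, ← AlgHom.comp_apply, h1])
  constructor
  · rw [← h2]
    exact polyE_injective.comp (Function.LeftInverse.injective h3)
  · have := polyE_surjective
    rw [← h1] at this
    exact Function.Surjective.of_comp this

/-- The isomorphism `ℤ[h₁, h₂, …] ≃ Λ`. -/
noncomputable def polyHEquiv : MvPolynomial ℕ ℤ ≃ₐ[ℤ] SymFun :=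
  AlgEquiv.ofBijective polyH polyH_bijective

/-- The operation `f ∘ a` of a symmetric function `f` on a pre-`λ`-ring: the ring homomorphism
`f ↦ f ∘ a` from `Λ = ℤ[h₁, h₂, …]` sends `hₙ` to `σₙ(a)`. On `A = Λ` this is plethysm. -/
noncomputable def circ {A : Type*} [CommRing A] [PreLambdaRing A] (f : SymFun) (a : A) : A :=
  MvPolynomial.aeval (fun i => PreLambdaRing.σ (i + 1) a) (polyHEquiv.symm f)

theorem polyHEquiv_X (n : ℕ) : polyHEquiv (MvPolynomial.X n) = hSymm (n + 1) :=
  MvPolynomial.aeval_X _ _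

theorem circ_hSymm {A : Type*} [CommRing A] [PreLambdaRing A] (n : ℕ) (a : A) :
    circ (hSymm n) a = PreLambdaRing.σ n a := by
  cases n with
  | zero => rw [circ, hSymm_zero, map_one, map_one, PreLambdaRing.σ_zero]
  | succ n =>
    rw [circ, ← polyHEquiv_X, AlgEquiv.symm_apply_apply, MvPolynomial.aeval_X]

/-- A `λ`-ring: a pre-`λ`-ring with `f ∘ (g ∘ x) = (f ∘ g) ∘ x` for all `f, g ∈ Λ`. -/
class LambdaRing (R : Type*) [CommRing R] extends PreLambdaRing R where
  circ_circ : ∀ (f g : SymFun) (x : R), circ f (circ g x) = circ (circ f g) x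

open Classical in
/-- The power sum `pₙ = ∑ᵢ xᵢ^n`, for `n ≥ 1`. -/
noncomputable def pSum (n : ℕ) : SymFun :=
  SymFun.ofCoeff (fun m => if ∃ i, m = Finsupp.single i n then 1 else 0) n
    (fun e m => by
      have : (∃ i, m.mapDomain e = Finsupp.single i n) ↔ ∃ i, m = Finsupp.single i n := by
        rw [← e.exists_congr_right]
        refine exists_congr fun i => ?_
        rw [← Finsupp.mapDomain_single (f := e)]
        exact (Finsupp.mapDomain_injective e.injective).eq_iff
      simp only [this])
    (fun m hm => by
      by_contra hlt
      refine hm (if_neg ?_)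
      rintro ⟨i, rfl⟩
      simp at hlt)

/-- `hₙ` for `n ∈ ℤ`, with `hₙ = 0` for `n < 0`. -/
noncomputable def hInt : ℤ → SymFun
  | Int.ofNat n => hSymm n
  | Int.negSucc _ => 0

/-- The Schur function `s_λ = det (h_{λᵢ - i + j})` of a partition `λ` of `n`; here `lam.parts`
is the multiset of its parts, sorted in decreasing order. -/
noncomputable def schur {n : ℕ} (lam : n.Partition) : SymFun :=
  Matrix.det (Matrix.of fun i j : Fin (lam.parts.sort (· ≥ ·)).length =>
    hInt (((lam.parts.sort (· ≥ ·)).get i : ℤ) - (i : ℤ) + (j : ℤ)))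

/-- The element `F ⊗ r = F · r` of `Λ ⊗̂ R`, for `F` in the completion of `Λ` and `r ∈ R`. -/
noncomputable def tmul {R : Type*} [CommRing R] (F : SymSeries ℤ) (r : R) : SymSeries R :=
  ⟨fun m => ((MvPowerSeries.coeff m F.1 : ℤ) : R) * r, fun e m =>
    congrArg (fun c : ℤ => (c : R) * r) (F.2 e m)⟩

/-- The `n`-th step of the filtration by degree: the series all of whose terms have degree `≥ n`. -/
def filtration (A : Type*) [CommRing A] (n : ℕ) : Set (MvPowerSeries ℕ A) :=
  {F | ∀ m : ℕ →₀ ℕ, m.degree < n → MvPowerSeries.coeff m F = 0}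

/-- Convergence of a sequence of power series in the topology of the filtration by degree. -/
def ConvergesTo {A : Type*} [CommRing A] (u : ℕ → MvPowerSeries ℕ A) (F : MvPowerSeries ℕ A) :
    Prop :=
  ∀ n, ∃ N₀, ∀ N, N₀ ≤ N → u N - F ∈ filtration A n

/-- `Exp(F) = ∑ₙ σₙ(F)` on `Λ ⊗̂ R`, coefficient by coefficient. For `F` in the first step of the
filtration, `σₙ(F)` is in the `n`-th step, so that each coefficient is a finite sum. -/
noncomputable def Exp {R : Type*} [CommRing R] [PreLambdaRing R] (F : SymSeries R) :
    SymSeries R :=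
  ⟨fun m => ∑ᶠ n : ℕ, MvPowerSeries.coeff m (PreLambdaRing.σ n F).1, fun e m =>
    finsum_congr fun n => (PreLambdaRing.σ n F).2 e m⟩

/-- `Log`, the inverse of `Exp : F¹ → 1 + F¹` on `Λ ⊗̂ R`. -/
noncomputable def Log {R : Type*} [CommRing R] [PreLambdaRing R] (G : SymSeries R) :
    SymSeries R :=
  Function.invFunOn Exp {F : SymSeries R | (F : MvPowerSeries ℕ R) ∈ filtration R 1} G

/-- The power sum `pₖ` with coefficients in `A`. -/
noncomputable def pIn (A : Type*) [CommRing A] (k : ℕ) : MvPowerSeries ℕ A :=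
  MvPowerSeries.map (Int.castRingHom A) (pSum k).1.1

/-- `log(1 + u) = ∑_{n ≥ 1} (-1)^(n-1) u^n / n`, for `u` without constant term. -/
noncomputable def logOneAdd {A : Type*} [CommRing A] [Algebra ℚ A] (u : MvPowerSeries ℕ A) :
    MvPowerSeries ℕ A :=
  (PowerSeries.log A).subst u

/-- `(1 + u)^c = exp(c log(1 + u))`, for `u` without constant term. -/
noncomputable def oneAddPow {A : Type*} [CommRing A] [Algebra ℚ A] (u : MvPowerSeries ℕ A)
    (c : A) : MvPowerSeries ℕ A :=
  (PowerSeries.exp A).subst (MvPowerSeries.C c * logOneAdd u)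

open scoped TensorProduct in
/-- The exponent `(1/k) ∑_{d ∣ k} μ(k/d) ψ_d(x)` in `ℚ ⊗ R`, where `ψ_d(x) = p_d ∘ x` is the
`d`-th Adams operation. -/
noncomputable def phiExponent {R : Type*} [CommRing R] [PreLambdaRing R] (k : ℕ) (x : R) :
    ℚ ⊗[ℤ] R :=
  ∑ d ∈ k.divisors, ((ArithmeticFunction.moebius (k / d) : ℚ) / (k : ℚ)) ⊗ₜ[ℤ] circ (pSum d) x

/-- The canonical map from `Λ ⊗̂ R` to the power series over `ℚ ⊗ R`. -/
noncomputable def toRat {R : Type*} [CommRing R] (F : SymSeries R) :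
    MvPowerSeries ℕ (TensorProduct ℤ ℚ R) :=
  MvPowerSeries.map
    (Algebra.TensorProduct.includeRight (R := ℤ) (A := ℚ) (B := R)).toRingHom F.1

/-- The partial sum `∑_{|λ| < N} s_λ ⊗ y_λ`. -/
noncomputable def schurSum {R : Type*} [CommRing R] (y : (n : ℕ) → n.Partition → R) (N : ℕ) :
    MvPowerSeries ℕ R :=
  ∑ n ∈ range N, ∑ lam : n.Partition, (tmul (schur lam).1 (y n lam)).1

/-- The partial product `∏_{1 ≤ k ≤ N} (1 + pₖ)^((1/k) ∑_{d ∣ k} μ(k/d) ψ_d(x))`. -/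
noncomputable def phiProd {R : Type*} [CommRing R] [PreLambdaRing R] (x : R) (N : ℕ) :
    MvPowerSeries ℕ (TensorProduct ℤ ℚ R) :=
  ∏ k ∈ Icc 1 N, oneAddPow (pIn (TensorProduct ℤ ℚ R) k) (phiExponent k x)

end LambdaRings

open LambdaRings

/-! The map `Exp` sends `∑ₘ cₘ x^m` to the product over `m` of the factors `∑ⱼ σⱼ(cₘ) x^(j m)`. The
coefficient of `x^M` in it is `c_M` plus an expression in the coefficients of lower degree
(`coeff_expSeries_eq_add`). So `Exp F = G` is solved by recursion on the degree for every `G` with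
constant term `1`, and the solution stays symmetric. Hence `Log(1 + p₁)` exists over `ℤ`.

The product formulas are compared through logarithmic derivatives for the Euler operator `E`, which
over a `ℚ`-algebra determine a series with constant term `1` (`coeff_eq_of_euler_eq`). By Newton's
identities the logarithmic derivative of `σ_t(a)` is `∑ ψₙ(a) t^n`, so that of `Exp(F)` is `∑ₘ |m|
∑_{j ≥ 1} ψⱼ(cₘ) x^(j m)`. Along the multiples `g m` of a primitive exponent `m`, everything becomes
Dirichlet convolution in `g`. Let `L(g)` be `|g m|` times the coefficient of `x^(g m)` in `Log(1 +
p₁)`. As `ψₙ` is the identity on `ℤ`, `E log(1 + p₁)` has coefficients `ζ * L`. The series `E log(1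
+ p_k)` arises from it by `xᵢ ↦ xᵢ^k` and a factor `k`. Hence weights `c_k` with `k c_k = a(k)` give
`∑ c_k E log(1 + p_k)` the coefficients `a * ζ * L` (`coeff_nsmul_sum_euler_logOneAdd`). For `a = μ`
this is `L`, the formula for `Log(1 + p₁)`. For `a = μ * ψ(x)` it is `ψ(x) * L`, the logarithmic
derivative of `Exp(Log(1 + p₁) x)`, because `ψₙ(c x) = c ψₙ(x)` for `c ∈ ℤ`.

For the expansion in Schur functions, the Jacobi–Trudi determinant is unitriangular with respect to
the sum of the squares of the indices, so Schur functions span `Λ` over `ℤ`. Expanding the monomial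
symmetric functions in them inverts the matrix of coefficients over `ℤ`. A symmetric series over any
commutative ring then has exactly one Schur expansion (`convergesTo_schurSum_iff`), which is applied
over both `R` and `ℚ ⊗ R`. The operations are universal since `σⱼ(c x)`, for `c ∈ ℤ`, is the
coefficient of `t^j` in `(∑ hₙ t^n)^c`, applied to `x`. -/

namespace LambdaRings

open Finset

/-! ### The Euler operator and logarithmic derivatives. -/

section euler

/-- The Euler operator `∑ᵢ xᵢ ∂/∂xᵢ`, which multiplies the coefficient of `x^m` by the degree
of `m`. -/
noncomputable def euler (A : Type*) [CommRing A] :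
    Derivation A (MvPowerSeries ℕ A) (MvPowerSeries ℕ A) where
  toFun F := fun m => (m.degree : A) * MvPowerSeries.coeff m F
  map_add' F G := by
    ext m
    change (m.degree : A) * MvPowerSeries.coeff m (F + G) =
      (m.degree : A) * MvPowerSeries.coeff m F + (m.degree : A) * MvPowerSeries.coeff m G
    rw [map_add, mul_add]
  map_smul' c F := by
    ext m
    change (m.degree : A) * MvPowerSeries.coeff m (c • F) =
      c * ((m.degree : A) * MvPowerSeries.coeff m F)
    rw [MvPowerSeries.coeff_smul]
    ring
  map_one_eq_zero' := by
    classical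
    ext m
    change (m.degree : A) * MvPowerSeries.coeff m 1 = 0
    rw [MvPowerSeries.coeff_one]
    split_ifs with h <;> simp [h]
  leibniz' F G := by
    classical
    ext m
    rw [map_add, smul_eq_mul, smul_eq_mul, MvPowerSeries.coeff_mul, MvPowerSeries.coeff_mul]
    change (m.degree : A) * MvPowerSeries.coeff m (F * G) =
      ∑ p ∈ antidiagonal m, MvPowerSeries.coeff p.1 F *
        ((p.2.degree : A) * MvPowerSeries.coeff p.2 G) +
      ∑ p ∈ antidiagonal m, MvPowerSeries.coeff p.1 G *
        ((p.2.degree : A) * MvPowerSeries.coeff p.2 F)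
    rw [Finsupp.sum_antidiagonal_swap m (fun a b => MvPowerSeries.coeff a G *
        ((b.degree : A) * MvPowerSeries.coeff b F)),
      MvPowerSeries.coeff_mul, mul_sum, ← sum_add_distrib]
    refine sum_congr rfl fun p hp => ?_
    rw [← HasAntidiagonal.mem_antidiagonal.1 hp, map_add]
    push_cast
    ring

variable {A : Type*} [CommRing A]

theorem coeff_euler (F : MvPowerSeries ℕ A) (m : ℕ →₀ ℕ) :
    MvPowerSeries.coeff m (euler A F) = (m.degree : A) * MvPowerSeries.coeff m F := rfl

theorem coeff_pow_of_degree_lt {u : MvPowerSeries ℕ A} (hu : MvPowerSeries.constantCoeff u = 0)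
    {d : ℕ} {m : ℕ →₀ ℕ} (h : m.degree < d) : MvPowerSeries.coeff m (u ^ d) = 0 := by
  refine MvPowerSeries.coeff_of_lt_order (lt_of_lt_of_le ?_
    (MvPowerSeries.le_order_pow_of_constantCoeff_eq_zero d hu))
  exact_mod_cast h

/-- Since `u^d` has order at least `d`, only the terms with `d < n` matter. This reduces
substitution to polynomial evaluation, where the chain rule for derivations is available. -/
theorem coeff_subst_eq_trunc {u : MvPowerSeries ℕ A} (hu : MvPowerSeries.constantCoeff u = 0)
    (f : PowerSeries A) {m : ℕ →₀ ℕ} {n : ℕ} (h : m.degree < n) :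
    MvPowerSeries.coeff m (f.subst u) =
      MvPowerSeries.coeff m (Polynomial.aeval u (PowerSeries.trunc n f)) := by
  have hs := PowerSeries.HasSubst.of_constantCoeff_zero hu
  rw [← PowerSeries.subst_coe hs, PowerSeries.coeff_subst hs, PowerSeries.coeff_subst hs]
  refine finsum_congr fun d => ?_
  rcases lt_or_ge d n with hd | hd
  · rw [Polynomial.coeff_coe, PowerSeries.coeff_trunc, if_pos hd]
  · rw [coeff_pow_of_degree_lt hu (h.trans_le hd), smul_zero, smul_zero]

/-- The chain rule for the Euler operator. -/
theorem euler_subst {u : MvPowerSeries ℕ A} (hu : MvPowerSeries.constantCoeff u = 0)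
    (f : PowerSeries A) :
    euler A (f.subst u) = (PowerSeries.derivative A f).subst u * euler A u := by
  classical
  ext m
  -- Differentiation lowers the truncation bound by one; the derivative must still be exact up to
  -- degree `m.degree`, hence `+ 2`.
  rw [coeff_euler, coeff_subst_eq_trunc hu f (n := m.degree + 2) (by omega), ← coeff_euler,
    Derivation.comp_aeval_eq, smul_eq_mul, MvPowerSeries.coeff_mul, MvPowerSeries.coeff_mul]
  refine sum_congr rfl fun p hp => ?_
  have hp' := congrArg Finsupp.degree (HasAntidiagonal.mem_antidiagonal.1 hp)
  rw [map_add] at hp'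
  rw [coeff_subst_eq_trunc hu _ (n := m.degree + 1) (by omega), PowerSeries.trunc_derivative]

theorem constantCoeff_subst_of_constantCoeff {u : MvPowerSeries ℕ A}
    (hu : MvPowerSeries.constantCoeff u = 0) (f : PowerSeries A) :
    MvPowerSeries.constantCoeff (f.subst u) = PowerSeries.constantCoeff f := by
  rw [← MvPowerSeries.coeff_zero_eq_constantCoeff_apply,
    coeff_subst_eq_trunc hu f (n := 1) (by simp)]
  simp [PowerSeries.trunc_one_left, MvPowerSeries.algebraMap_apply]

/-- A power series with constant term `1` is determined by its logarithmic derivative, degree by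
degree. -/
theorem coeff_eq_of_euler_eq [Algebra ℚ A] {N : ℕ} {P G V W : MvPowerSeries ℕ A}
    (hP : euler A P = P * V) (hG : euler A G = G * W)
    (hVW : ∀ m : ℕ →₀ ℕ, m.degree ≤ N → MvPowerSeries.coeff m V = MvPowerSeries.coeff m W)
    (hW : MvPowerSeries.coeff 0 W = 0)
    (h0 : MvPowerSeries.coeff 0 P = MvPowerSeries.coeff 0 G) {m : ℕ →₀ ℕ} (hm : m.degree ≤ N) :
    MvPowerSeries.coeff m P = MvPowerSeries.coeff m G := by
  classical
  induction hd : m.degree using Nat.strong_induction_on generalizing m with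
  | _ d ih =>
    rcases Nat.eq_zero_or_pos d with rfl | hpos
    · rw [Finsupp.degree_eq_zero_iff] at hd
      rw [hd, h0]
    -- The degree is positive, so it can be cancelled over a `ℚ`-algebra; this is what makes the
    -- recursion determine the coefficient.
    have hunit : IsUnit (m.degree : A) := by
      have : IsUnit (algebraMap ℚ A (m.degree : ℚ)) :=
        (IsUnit.mk0 _ (by rw [Nat.cast_ne_zero]; omega)).map _
      simpa using this
    refine hunit.mul_left_cancel ?_
    rw [← coeff_euler, ← coeff_euler, hP, hG, MvPowerSeries.coeff_mul, MvPowerSeries.coeff_mul]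
    refine sum_congr rfl fun p hp => ?_
    have hp' := congrArg Finsupp.degree (HasAntidiagonal.mem_antidiagonal.1 hp)
    rw [map_add] at hp'
    rw [hVW p.2 (by omega)]
    -- The term with `p.2 = 0` contains the unknown coefficient at `m` itself; it drops out because
    -- `W` has no constant term.
    by_cases h2 : p.2 = 0
    · rw [h2, hW, mul_zero, mul_zero]
    · have : p.2.degree ≠ 0 := by rwa [Ne, Finsupp.degree_eq_zero_iff]
      rw [ih p.1.degree (by omega) (by omega) rfl]

variable [Algebra ℚ A]

theorem constantCoeff_logOneAdd {u : MvPowerSeries ℕ A}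
    (hu : MvPowerSeries.constantCoeff u = 0) :
    MvPowerSeries.constantCoeff (logOneAdd u) = 0 := by
  rw [logOneAdd, constantCoeff_subst_of_constantCoeff hu, PowerSeries.constantCoeff_log]

/-- Substitute `u` into `(1 + X) log'(1 + X) = 1`. The form without inverses is transported by ring
homomorphisms and used by cancelling the unit `1 + u`. -/
theorem one_add_mul_euler_logOneAdd {u : MvPowerSeries ℕ A}
    (hu : MvPowerSeries.constantCoeff u = 0) :
    (1 + u) * euler A (logOneAdd u) = euler A u := by
  have hs := PowerSeries.HasSubst.of_constantCoeff_zero hu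
  have h : (1 + PowerSeries.X) * PowerSeries.derivative A (PowerSeries.log A) = 1 := by
    rw [PowerSeries.deriv_log]
    ext n
    cases n with
    | zero => simp
    | succ n => simp [add_mul, PowerSeries.coeff_succ_X_mul, PowerSeries.coeff_one, pow_succ]
  have h' := congrArg (PowerSeries.substAlgHom hs) h
  rw [map_mul, map_add, map_one, PowerSeries.substAlgHom_X, PowerSeries.coe_substAlgHom] at h'
  rw [logOneAdd, euler_subst hu, ← mul_assoc, h', one_mul]

theorem constantCoeff_oneAddPow {u : MvPowerSeries ℕ A}
    (hu : MvPowerSeries.constantCoeff u = 0) (c : A) :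
    MvPowerSeries.constantCoeff (oneAddPow u c) = 1 := by
  rw [oneAddPow, constantCoeff_subst_of_constantCoeff, PowerSeries.constantCoeff_exp]
  rw [map_mul, constantCoeff_logOneAdd hu, mul_zero]

theorem euler_oneAddPow {u : MvPowerSeries ℕ A}
    (hu : MvPowerSeries.constantCoeff u = 0) (c : A) :
    euler A (oneAddPow u c) =
      oneAddPow u c * (MvPowerSeries.C c * euler A (logOneAdd u)) := by
  rw [oneAddPow, euler_subst]
  · rw [PowerSeries.derivative_exp, ← MvPowerSeries.smul_eq_C_mul, ← MvPowerSeries.smul_eq_C_mul,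
      Derivation.map_smul]
  · rw [map_mul, constantCoeff_logOneAdd hu, mul_zero]

end euler

/-! ### Setting `t = 1` in power series in `t` adapted to the filtration. -/

section evalOne
variable {A : Type*} [CommRing A]

/-- The square exceeds the triangle `i + j < N` only by terms where `f` vanishes. -/
theorem sum_range_sum_antidiagonal {N : ℕ} (f : ℕ → ℕ → A)
    (hf : ∀ i j, N ≤ i + j → f i j = 0) :
    ∑ n ∈ range N, ∑ ij ∈ antidiagonal n, f ij.1 ij.2 = ∑ i ∈ range N, ∑ j ∈ range N, f i j := by
  rw [← sum_product']
  rw [← sum_filter_add_sum_filter_not (range N ×ˢ range N) (fun ij => ij.1 + ij.2 < N)]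
  rw [sum_eq_zero (s := filter (fun ij : ℕ × ℕ => ¬ ij.1 + ij.2 < N) _), add_zero]
  · rw [← sum_fiberwise_of_maps_to (t := range N) (g := fun ij : ℕ × ℕ => ij.1 + ij.2)]
    · refine sum_congr rfl fun n hn => sum_congr ?_ fun _ _ => rfl
      ext ij
      simp only [HasAntidiagonal.mem_antidiagonal, mem_filter, mem_product, mem_range] at *
      omega
    · intro ij hij
      simp only [mem_filter, mem_range] at *
      exact hij.2
  · intro ij hij
    simp only [mem_filter, not_lt] at hij
    exact hf _ _ hij.2

/-- The power series `P(t)`, `t = 1`, for a power series `P = ∑ₙ Pₙ t^n` such that `Pₙ` is in the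
`n`-th step of the filtration. -/
noncomputable def evalOne (P : PowerSeries (MvPowerSeries ℕ A)) : MvPowerSeries ℕ A :=
  fun M => ∑ n ∈ range (M.degree + 1), MvPowerSeries.coeff M (PowerSeries.coeff n P)

theorem coeff_evalOne {P : PowerSeries (MvPowerSeries ℕ A)}
    (hP : ∀ n, PowerSeries.coeff n P ∈ filtration A n) {M : ℕ →₀ ℕ} {N : ℕ} (hN : M.degree < N) :
    MvPowerSeries.coeff M (evalOne P) =
      ∑ n ∈ range N, MvPowerSeries.coeff M (PowerSeries.coeff n P) := by
  change ∑ n ∈ range (M.degree + 1), MvPowerSeries.coeff M (PowerSeries.coeff n P) = _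
  refine sum_subset (range_subset_range.2 hN) fun n _ hn => hP n M ?_
  rw [mem_range] at hn
  omega

theorem coeff_mul_mem_filtration {P Q : PowerSeries (MvPowerSeries ℕ A)}
    (hP : ∀ n, PowerSeries.coeff n P ∈ filtration A n)
    (hQ : ∀ n, PowerSeries.coeff n Q ∈ filtration A n) (n : ℕ) :
    PowerSeries.coeff n (P * Q) ∈ filtration A n := by
  classical
  intro M hM
  rw [PowerSeries.coeff_mul, map_sum]
  refine sum_eq_zero fun ij hij => ?_
  rw [MvPowerSeries.coeff_mul]
  refine sum_eq_zero fun ab hab => ?_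
  have h1 := mem_antidiagonal.1 hij
  have h2 := congrArg Finsupp.degree (HasAntidiagonal.mem_antidiagonal.1 hab)
  rw [map_add] at h2
  rcases lt_or_ge ab.1.degree ij.1 with h | h
  · rw [hP _ _ h, zero_mul]
  · rw [hQ _ _ (by omega), mul_zero]

/-- By the filtration condition, a pair of `t`-degrees `i, j` contributes to the coefficient at `M`
only if `i + j ≤ |M|`, so all sums are finite and the product may be rearranged. -/
theorem evalOne_mul {P Q : PowerSeries (MvPowerSeries ℕ A)}
    (hP : ∀ n, PowerSeries.coeff n P ∈ filtration A n)
    (hQ : ∀ n, PowerSeries.coeff n Q ∈ filtration A n) :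
    evalOne (P * Q) = evalOne P * evalOne Q := by
  classical
  ext M
  rw [coeff_evalOne (coeff_mul_mem_filtration hP hQ) (Nat.lt_succ_self _), MvPowerSeries.coeff_mul]
  simp only [PowerSeries.coeff_mul, map_sum]
  simp only [MvPowerSeries.coeff_mul]
  rw [sum_congr rfl fun n _ => sum_comm, sum_comm]
  refine sum_congr rfl fun ab hab => ?_
  have h2 := congrArg Finsupp.degree (HasAntidiagonal.mem_antidiagonal.1 hab)
  rw [map_add] at h2
  rw [coeff_evalOne hP (N := M.degree.succ) (by omega),
    coeff_evalOne hQ (N := M.degree.succ) (by omega), sum_mul_sum,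
    ← sum_range_sum_antidiagonal (fun i j => MvPowerSeries.coeff ab.1 (PowerSeries.coeff i P) *
      MvPowerSeries.coeff ab.2 (PowerSeries.coeff j Q))]
  intro i j hij
  rcases lt_or_ge ab.1.degree i with h | h
  · rw [hP _ _ h, zero_mul]
  · rw [hQ _ _ (by omega), mul_zero]

theorem coeff_one_mem_filtration (n : ℕ) :
    PowerSeries.coeff n (1 : PowerSeries (MvPowerSeries ℕ A)) ∈ filtration A n := by
  intro M hM
  rw [PowerSeries.coeff_one, if_neg (by omega), map_zero]

theorem evalOne_one : evalOne (1 : PowerSeries (MvPowerSeries ℕ A)) = 1 := by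
  ext M
  change ∑ n ∈ range (M.degree + 1), MvPowerSeries.coeff M
    (PowerSeries.coeff n (1 : PowerSeries (MvPowerSeries ℕ A))) = _
  rw [sum_range_succ', sum_eq_zero]
  · simp
  · intro n _
    rw [PowerSeries.coeff_one, if_neg (by omega), map_zero]

/-- The two assertions are proved together, since multiplicativity at each step needs the filtration
condition for the partial product. -/
theorem evalOne_prod {ι : Type*} (s : Finset ι) (P : ι → PowerSeries (MvPowerSeries ℕ A))
    (hP : ∀ i n, PowerSeries.coeff n (P i) ∈ filtration A n) :
    (∀ n, PowerSeries.coeff n (∏ i ∈ s, P i) ∈ filtration A n) ∧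
      evalOne (∏ i ∈ s, P i) = ∏ i ∈ s, evalOne (P i) := by
  classical
  induction s using Finset.induction_on with
  | empty => exact ⟨coeff_one_mem_filtration, evalOne_one⟩
  | insert a s ha ih =>
    rw [prod_insert ha, prod_insert ha, ← ih.2]
    exact ⟨coeff_mul_mem_filtration (hP a) ih.1, evalOne_mul (hP a) ih.1⟩

end evalOne

/-! ### `Exp` as a product over monomials. -/

section exponential
variable {R : Type*} [CommRing R] [PreLambdaRing R]

theorem genSeries_of_coeff_eq_zero {F : MvPowerSeries ℕ R} {m : ℕ →₀ ℕ}
    (h : MvPowerSeries.coeff m F = 0) : genSeries F m = 1 := by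
  ext1 j
  rw [genSeries, PowerSeries.coeff_mk, h, PowerSeries.coeff_one]
  split_ifs with hj
  · rw [hj, PreLambdaRing.σ_zero, zero_nsmul]
    rfl
  · rw [PreLambdaRing.σ_zero_right hj, map_zero]

theorem degree_nsmul_ge {m : ℕ →₀ ℕ} (hm : m ≠ 0) (j : ℕ) : j ≤ (j • m).degree := by
  rw [map_nsmul, smul_eq_mul]
  refine Nat.le_mul_of_pos_right j (Nat.pos_of_ne_zero ?_)
  rwa [Ne, Finsupp.degree_eq_zero_iff]

/-- For `m ≠ 0` the coefficient of `t^n` is a multiple of `x^(n m)`, of degree at least `n`; for `m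
= 0` the factor is `1` because `F` has no constant term. -/
theorem coeff_genSeries_mem_filtration {F : MvPowerSeries ℕ R} (hF : MvPowerSeries.coeff 0 F = 0)
    (m : ℕ →₀ ℕ) (n : ℕ) : PowerSeries.coeff n (genSeries F m) ∈ filtration R n := by
  classical
  by_cases hm : m = 0
  · subst hm
    rw [genSeries_of_coeff_eq_zero hF]
    exact coeff_one_mem_filtration n
  · intro M hM
    rw [genSeries, PowerSeries.coeff_mk, MvPowerSeries.coeff_monomial, if_neg]
    rintro rfl
    exact absurd (degree_nsmul_ge hm n) (not_le.2 hM)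

/-- The factor `∑ⱼ σⱼ(cₘ) x^(j m)` of `Exp(∑ₘ cₘ x^m)`. -/
noncomputable def expFactor (F : MvPowerSeries ℕ R) (m : ℕ →₀ ℕ) : MvPowerSeries ℕ R :=
  evalOne (genSeries F m)

theorem expFactor_of_coeff_eq_zero {F : MvPowerSeries ℕ R} {m : ℕ →₀ ℕ}
    (h : MvPowerSeries.coeff m F = 0) : expFactor F m = 1 := by
  rw [expFactor, genSeries_of_coeff_eq_zero h, evalOne_one]

theorem expFactor_congr {F G : MvPowerSeries ℕ R} {m : ℕ →₀ ℕ}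
    (h : MvPowerSeries.coeff m F = MvPowerSeries.coeff m G) : expFactor F m = expFactor G m := by
  rw [expFactor, expFactor, genSeries, genSeries, h]

theorem nsmul_left_injective_of_ne_zero {m : ℕ →₀ ℕ} (hm : m ≠ 0) :
    Function.Injective fun j : ℕ => j • m := by
  obtain ⟨i, hi⟩ := Finsupp.ne_iff.1 hm
  intro a b h
  have := DFunLike.congr_fun h i
  simp only [Finsupp.smul_apply, smul_eq_mul] at this
  exact Nat.eq_of_mul_eq_mul_right (Nat.pos_of_ne_zero hi) this

theorem coeff_nsmul_expFactor (F : MvPowerSeries ℕ R) {m : ℕ →₀ ℕ} (hm : m ≠ 0) (j : ℕ) :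
    MvPowerSeries.coeff (j • m) (expFactor F m) =
      PreLambdaRing.σ j (MvPowerSeries.coeff m F) := by
  classical
  change ∑ n ∈ range ((j • m).degree + 1), MvPowerSeries.coeff (j • m)
    (PowerSeries.coeff n (genSeries F m)) = _
  rw [sum_eq_single j]
  · rw [genSeries, PowerSeries.coeff_mk, MvPowerSeries.coeff_monomial_same]
  · intro n _ hn
    rw [genSeries, PowerSeries.coeff_mk, MvPowerSeries.coeff_monomial, if_neg]
    exact fun h => hn (nsmul_left_injective_of_ne_zero hm h.symm)
  · intro h
    rw [mem_range] at h
    have := degree_nsmul_ge hm j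
    omega

theorem coeff_expFactor_of_not_exists (F : MvPowerSeries ℕ R) {m M : ℕ →₀ ℕ}
    (h : ¬ ∃ j : ℕ, M = j • m) : MvPowerSeries.coeff M (expFactor F m) = 0 := by
  classical
  change ∑ n ∈ range (M.degree + 1), MvPowerSeries.coeff M
    (PowerSeries.coeff n (genSeries F m)) = _
  refine sum_eq_zero fun n _ => ?_
  rw [genSeries, PowerSeries.coeff_mk, MvPowerSeries.coeff_monomial, if_neg]
  exact fun h' => h ⟨n, h'⟩

theorem coeff_zero_expFactor (F : MvPowerSeries ℕ R) (m : ℕ →₀ ℕ) (hm : m ≠ 0) :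
    MvPowerSeries.coeff 0 (expFactor F m) = 1 := by
  have := coeff_nsmul_expFactor F hm 0
  rwa [zero_nsmul, PreLambdaRing.σ_zero] at this

/-- The power series `Exp(F) = ∑ₙ σₙ(F)`, for `F` without constant term. -/
noncomputable def expSeries (F : MvPowerSeries ℕ R) : MvPowerSeries ℕ R :=
  fun M => ∑ n ∈ range (M.degree + 1), MvPowerSeries.coeff M (sigmaSeries n F)

/-- `Exp(∑ₘ cₘ x^m) = ∏ₘ (∑ⱼ σⱼ(cₘ) x^(j m))`, coefficient by coefficient. -/
theorem coeff_expSeries {F : MvPowerSeries ℕ R} (hF : MvPowerSeries.coeff 0 F = 0)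
    {M : ℕ →₀ ℕ} {s : Finset (ℕ →₀ ℕ)} (hs : Iic M ⊆ s) :
    MvPowerSeries.coeff M (expSeries F) = MvPowerSeries.coeff M (∏ m ∈ s, expFactor F m) := by
  have h := (evalOne_prod s (genSeries F) (coeff_genSeries_mem_filtration hF)).2
  simp only [expFactor]
  rw [← h]
  change ∑ n ∈ range (M.degree + 1), MvPowerSeries.coeff M (sigmaSeries n F) =
    ∑ n ∈ range (M.degree + 1), MvPowerSeries.coeff M (PowerSeries.coeff n (∏ m ∈ s, genSeries F m))
  refine sum_congr rfl fun n _ => ?_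
  rw [coeff_prod_genSeries F s n M hs]

theorem sigmaSeries_mem_filtration {F : MvPowerSeries ℕ R} (hF : MvPowerSeries.coeff 0 F = 0)
    (n : ℕ) : sigmaSeries n F ∈ filtration R n := by
  intro M hM
  rw [← coeff_prod_genSeries F (Iic M) n M subset_rfl]
  exact (evalOne_prod _ (genSeries F) (coeff_genSeries_mem_filtration hF)).1 n M hM

theorem coe_Exp {F : SymSeries R} (hF : F.1 ∈ filtration R 1) : (Exp F).1 = expSeries F.1 := by
  have hF0 : MvPowerSeries.coeff 0 F.1 = 0 := hF 0 (by simp)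
  ext M
  change ∑ᶠ n : ℕ, MvPowerSeries.coeff M (PreLambdaRing.σ n F).1 = _
  rw [finsum_eq_sum_of_support_subset (s := range (M.degree + 1))]
  · rfl
  · intro n hn
    rw [coe_range, Set.mem_Iio]
    by_contra h
    exact hn (sigmaSeries_mem_filtration hF0 n M (by omega))

theorem coeff_zero_expSeries (F : MvPowerSeries ℕ R) :
    MvPowerSeries.coeff 0 (expSeries F) = 1 := by
  classical
  change ∑ n ∈ range ((0 : ℕ →₀ ℕ).degree + 1), _ = _
  rw [map_zero, zero_add, sum_range_one, sigmaSeries_zero, MvPowerSeries.coeff_one, if_pos rfl]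

theorem degree_lt_degree_of_lt {a b : ℕ →₀ ℕ} (h : a < b) : a.degree < b.degree := by
  obtain ⟨c, rfl⟩ := exists_add_of_le h.le
  have hc : c ≠ 0 := by
    rintro rfl
    simp at h
  have : c.degree ≠ 0 := by rwa [Ne, Finsupp.degree_eq_zero_iff]
  rw [map_add]
  omega

/-- The coefficient of `x^M` in `Exp(F)` is that of `F` plus an expression in the coefficients of
lower degree. -/
theorem coeff_expSeries_eq_add {F G : MvPowerSeries ℕ R} (hF : MvPowerSeries.coeff 0 F = 0)
    {M : ℕ →₀ ℕ} (hM : M ≠ 0)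
    (hG : ∀ m : ℕ →₀ ℕ, m.degree < M.degree → MvPowerSeries.coeff m G = MvPowerSeries.coeff m F)
    (hGM : MvPowerSeries.coeff M G = 0) :
    MvPowerSeries.coeff M (expSeries F) =
      MvPowerSeries.coeff M F + MvPowerSeries.coeff M (expSeries G) := by
  classical
  have hM' : M.degree ≠ 0 := by rwa [Ne, Finsupp.degree_eq_zero_iff]
  have hG0 : MvPowerSeries.coeff 0 G = 0 := by
    rw [hG 0 (by rw [map_zero]; omega), hF]
  -- The coefficient `c_M` enters only the factor at `M`. The other factors agree for `F` and `G`,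
  -- and the factor of `G` at `M` is `1`.
  have hI : Iic M = insert M (Iio M) := by
    ext m
    rw [mem_Iic, mem_insert, mem_Iio, le_iff_eq_or_lt]
  have hP : ∏ m ∈ Iio M, expFactor G m = ∏ m ∈ Iio M, expFactor F m :=
    prod_congr rfl fun m hm => expFactor_congr (hG m (degree_lt_degree_of_lt (mem_Iio.1 hm)))
  rw [coeff_expSeries hF subset_rfl, coeff_expSeries hG0 subset_rfl, hI,
    prod_insert (by simp), prod_insert (by simp), hP, expFactor_of_coeff_eq_zero hGM, one_mul]
  generalize hQ : ∏ m ∈ Iio M, expFactor F m = Q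
  have hQ0 : MvPowerSeries.coeff 0 Q = 1 := by
    rw [← hQ, MvPowerSeries.coeff_zero_eq_constantCoeff_apply, map_prod]
    refine prod_eq_one fun m _ => ?_
    by_cases hm : m = 0
    · rw [hm, expFactor_of_coeff_eq_zero hF, map_one]
    · exact coeff_zero_expFactor F m hm
  -- The factor at `M` is supported on the multiples `j M`, and the total degree excludes `j ≥ 2`;
  -- so only `j = 1` and `j = 0` remain.
  rw [MvPowerSeries.coeff_mul, sum_eq_add (M, 0) (0, M)]
  · have h1 := coeff_nsmul_expFactor F hM 1
    rw [one_nsmul, PreLambdaRing.σ_one] at h1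
    rw [h1, hQ0, coeff_zero_expFactor F M hM, one_mul, mul_one]
  · simp [hM]
  · intro ab hab hne
    rw [HasAntidiagonal.mem_antidiagonal] at hab
    rw [coeff_expFactor_of_not_exists, zero_mul]
    rintro ⟨j, hj⟩
    have h2 := congrArg Finsupp.degree hab
    rw [hj, map_add, map_nsmul, smul_eq_mul] at h2
    rcases Nat.lt_or_ge j 2 with hj2 | hj2
    · interval_cases j
      · rw [zero_nsmul] at hj
        refine hne.2 (Prod.ext hj ?_)
        rw [← hab, hj, zero_add]
      · rw [one_nsmul] at hj
        refine hne.1 (Prod.ext hj ?_)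
        rw [hj] at hab
        simpa using hab
    · have : 2 * M.degree ≤ j * M.degree := Nat.mul_le_mul_right _ hj2
      omega
  · intro h
    exact absurd (HasAntidiagonal.mem_antidiagonal.2 (by simp)) h
  · intro h
    exact absurd (HasAntidiagonal.mem_antidiagonal.2 (by simp)) h

end exponential

/-! ### Existence of `Log`. -/

section logarithm
variable {R : Type*} [CommRing R] [PreLambdaRing R]

/-- The power series with given coefficients. -/
def ofCoeffs {A : Type*} (c : (ℕ →₀ ℕ) → A) : MvPowerSeries ℕ A := c

theorem coeff_ofCoeffs {A : Type*} [CommRing A] (c : (ℕ →₀ ℕ) → A) (m : ℕ →₀ ℕ) :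
    MvPowerSeries.coeff m (ofCoeffs c) = c m := rfl

/-- The coefficients of `Log(G)`, by recursion on the degree. -/
noncomputable def logCoeff (G : MvPowerSeries ℕ R) (M : ℕ →₀ ℕ) : R :=
  MvPowerSeries.coeff M G - MvPowerSeries.coeff M
    (expSeries (ofCoeffs fun m => if _h : m.degree < M.degree then logCoeff G m else 0))
termination_by M.degree

theorem logCoeff_zero {G : MvPowerSeries ℕ R} (hG : MvPowerSeries.coeff 0 G = 1) :
    logCoeff G 0 = 0 := by
  rw [logCoeff, hG, coeff_zero_expSeries, sub_self]

theorem expSeries_logCoeff {G : MvPowerSeries ℕ R} (hG : MvPowerSeries.coeff 0 G = 1) :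
    expSeries (ofCoeffs (logCoeff G)) = G := by
  ext M
  by_cases hM : M = 0
  · rw [hM, hG, coeff_zero_expSeries]
  rw [coeff_expSeries_eq_add (F := ofCoeffs (logCoeff G)) (logCoeff_zero hG) hM
    (G := ofCoeffs fun m => if h : m.degree < M.degree then logCoeff G m else 0)]
  · change logCoeff G M + _ = _
    rw [logCoeff, sub_add_cancel]
  · intro m hm
    exact dif_pos hm
  · exact dif_neg (lt_irrefl _)

/-- Inductively, the truncation below degree `d` is symmetric, and `sigmaSeries` preserves symmetry,
so the recursion yields symmetric coefficients in degree `d`. -/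
theorem logCoeff_mapDomain {G : MvPowerSeries ℕ R} (hG : G ∈ SymSeries R) (e : ℕ ≃ ℕ)
    (M : ℕ →₀ ℕ) : logCoeff G (M.mapDomain e) = logCoeff G M := by
  induction hd : M.degree using Nat.strong_induction_on generalizing M e with
  | _ d ih =>
    rw [logCoeff, logCoeff, hG, Finsupp.degree_mapDomain, hd]
    congr 1
    have hT : ofCoeffs (fun m => if _h : m.degree < d then logCoeff G m else 0) ∈ SymSeries R := by
      intro e' m
      change (if h : (m.mapDomain e').degree < d then logCoeff G (m.mapDomain e') else 0) =
        if h : m.degree < d then logCoeff G m else 0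
      rw [Finsupp.degree_mapDomain]
      split_ifs with h
      · exact ih _ h e' m rfl
      · rfl
    change ∑ n ∈ range _, _ = ∑ n ∈ range _, _
    rw [Finsupp.degree_mapDomain]
    exact sum_congr rfl fun n _ => sigmaSeries_mem n hT e M

/-- `Log` is a chosen preimage, meaningful only when one exists; the recursive solution provides it.
-/
theorem exists_Exp_eq {G : SymSeries R} (hG : MvPowerSeries.coeff 0 G.1 = 1) :
    ∃ F : SymSeries R, F.1 ∈ filtration R 1 ∧ Exp F = G := by
  have hF : ofCoeffs (logCoeff G.1) ∈ filtration R 1 := by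
    intro m hm
    rw [(Finsupp.degree_eq_zero_iff m).1 (by omega)]
    exact logCoeff_zero hG
  refine ⟨⟨ofCoeffs (logCoeff G.1), logCoeff_mapDomain G.2⟩, hF, Subtype.ext ?_⟩
  rw [coe_Exp hF]
  exact expSeries_logCoeff hG

theorem Log_mem_filtration {G : SymSeries R} (hG : MvPowerSeries.coeff 0 G.1 = 1) :
    (Log G).1 ∈ filtration R 1 :=
  Function.invFunOn_mem (exists_Exp_eq hG)

theorem Exp_Log {G : SymSeries R} (hG : MvPowerSeries.coeff 0 G.1 = 1) : Exp (Log G) = G :=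
  Function.invFunOn_eq (exists_Exp_eq hG)

end logarithm

/-! ### Newton's identities between power sums and complete symmetric functions. -/

section newton

open Classical in
theorem cf_pSum (n : ℕ) (m : ℕ →₀ ℕ) :
    cf m (pSum n) = if ∃ i, m = Finsupp.single i n then 1 else 0 := rfl

theorem cfHom_apply (m : ℕ →₀ ℕ) (f : SymFun) : cfHom m f = cf m f := rfl

/-- Splitting off a power `x_v^i` from `x^m` is possible exactly for the `v` with `i ≤ m v`, and the
cofactor automatically has degree `j`. -/
theorem cf_pSum_mul_hSymm {i j : ℕ} (hi : i ≠ 0) {m : ℕ →₀ ℕ} (hm : i + j = m.degree) :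
    cf m (pSum i * hSymm j) = #{v ∈ m.support | i ≤ m v} := by
  classical
  rw [cf_mul, card_eq_sum_ones, Nat.cast_sum]
  symm
  refine sum_of_injOn (fun v => (Finsupp.single v i, m - Finsupp.single v i)) ?_ ?_ ?_ ?_
  · intro v _ w _ h
    exact Finsupp.single_left_injective hi (Prod.ext_iff.1 h).1
  · intro v hv
    rw [mem_coe, mem_filter] at hv
    rw [mem_coe, HasAntidiagonal.mem_antidiagonal]
    exact add_tsub_cancel_of_le (Finsupp.single_le_iff.2 hv.2)
  · intro ab hab hne
    rw [HasAntidiagonal.mem_antidiagonal] at hab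
    rw [cf_pSum, if_neg, zero_mul]
    rintro ⟨v, hv⟩
    have hle : i ≤ m v := by
      rw [← Finsupp.single_le_iff, ← hv, ← hab]
      exact le_self_add
    refine hne ⟨v, ?_, Prod.ext hv.symm ?_⟩
    · rw [mem_coe, mem_filter, Finsupp.mem_support_iff]
      exact ⟨by omega, hle⟩
    · change m - Finsupp.single v i = ab.2
      rw [← hab, ← hv, add_tsub_cancel_left]
  · intro v hv
    rw [mem_filter] at hv
    have hle := Finsupp.single_le_iff.2 hv.2
    have h := congrArg Finsupp.degree (add_tsub_cancel_of_le hle)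
    rw [map_add, Finsupp.degree_single] at h
    have hj : (m - Finsupp.single v i).degree = j := by omega
    rw [cf_pSum, cf_hSymm, if_pos ⟨v, rfl⟩, if_pos hj]
    simp

/-- Newton's identities. -/
theorem newton_hSymm (n : ℕ) :
    (n : SymFun) * hSymm n =
      ∑ ij ∈ antidiagonal n, (if ij.1 = 0 then 0 else pSum ij.1) * hSymm ij.2 := by
  classical
  refine cf_ext fun m => ?_
  rw [← cfHom_apply, ← cfHom_apply, map_sum, ← nsmul_eq_mul, map_nsmul]
  simp only [cfHom_apply]
  by_cases hm : m.degree = n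
  · subst hm
    rw [cf_hSymm, if_pos rfl, nsmul_eq_mul, mul_one]
    have h : ∀ ij ∈ antidiagonal m.degree,
        cf m ((if ij.1 = 0 then 0 else pSum ij.1) * hSymm ij.2) =
          ∑ v ∈ m.support, if ij.1 ≠ 0 ∧ ij.1 ≤ m v then 1 else 0 := by
      intro ij hij
      by_cases h0 : ij.1 = 0
      · rw [if_pos h0, zero_mul, sum_eq_zero fun v _ => if_neg fun h => h.1 h0]
        exact map_zero (cfHom m)
      · rw [if_neg h0, cf_pSum_mul_hSymm h0 (HasAntidiagonal.mem_antidiagonal.1 hij), card_filter]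
        push_cast
        refine sum_congr rfl fun v _ => ?_
        simp [h0]
    -- After exchanging the sums, each variable `v` is counted once for every `i` with `1 ≤ i ≤ m
    -- v`, hence `m v` times; the total is the degree.
    rw [sum_congr rfl h, sum_comm, Finsupp.degree_apply, Nat.cast_sum]
    refine sum_congr rfl fun v hv => ?_
    rw [Nat.sum_antidiagonal_eq_sum_range_succ_mk, ← sum_filter, sum_const, nsmul_eq_mul, mul_one]
    have hle : m v ≤ m.degree := by
      rw [Finsupp.degree_apply]
      exact single_le_sum (f := m) (fun _ _ => Nat.zero_le _) hv
    have hI : filter (fun i => i ≠ 0 ∧ i ≤ m v) (range (∑ i ∈ m.support, m i).succ) =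
        Icc 1 (m v) := by
      rw [Finsupp.degree_apply] at hle
      ext i
      simp only [mem_filter, mem_range, mem_Icc]
      omega
    rw [hI, Nat.card_Icc, Nat.add_sub_cancel]
  -- Outside degree `n` both sides vanish by homogeneity.
  · rw [cf_hSymm, if_neg hm, smul_zero, sum_eq_zero]
    intro ij hij
    rw [HasAntidiagonal.mem_antidiagonal] at hij
    by_contra h
    split_ifs at h with h0
    · rw [zero_mul] at h
      exact h (map_zero (cfHom m))
    · have h1 : IsHomog ij.1 (pSum ij.1) := by
        intro m hm
        rw [cf_pSum] at hm
        by_contra hne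
        refine hm (if_neg ?_)
        rintro ⟨v, rfl⟩
        simp at hne
      have h2 : IsHomog ij.2 (hSymm ij.2) := by
        intro m hm
        rw [cf_hSymm] at hm
        by_contra hne
        exact hm (if_neg hne)
      exact hm ((h1.mul h2 m h).trans hij)

end newton

/-! ### Adams operations as the logarithmic derivative of `σ_t`. -/

section adams
variable {R : Type*} [CommRing R] [PreLambdaRing R]

/-- The ring homomorphism `f ↦ f ∘ a`. -/
noncomputable def circHom (a : R) : SymFun →+* R :=
  (MvPolynomial.aeval fun i => PreLambdaRing.σ (i + 1) a : MvPolynomial ℕ ℤ →ₐ[ℤ] R).toRingHom.comp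
    (polyHEquiv.symm : SymFun →+* MvPolynomial ℕ ℤ)

theorem circHom_apply (a : R) (f : SymFun) : circHom a f = circ f a := rfl

/-- The power series `σ_t(a) = ∑ₙ σₙ(a) t^n`. -/
noncomputable def sigmaGen (a : R) : PowerSeries R :=
  PowerSeries.mk fun n => PreLambdaRing.σ n a

/-- The power series `∑_{n ≥ 1} ψₙ(a) t^n`. -/
noncomputable def adamsGen (a : R) : PowerSeries R :=
  PowerSeries.mk fun n => if n = 0 then 0 else circ (pSum n) a

theorem sigmaGen_add (a b : R) : sigmaGen (a + b) = sigmaGen a * sigmaGen b := by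
  ext n
  rw [sigmaGen, PowerSeries.coeff_mk, PreLambdaRing.σ_add, PowerSeries.coeff_mul]
  simp only [sigmaGen, PowerSeries.coeff_mk]

theorem isUnit_sigmaGen (a : R) : IsUnit (sigmaGen a) := by
  rw [PowerSeries.isUnit_iff_constantCoeff, ← PowerSeries.coeff_zero_eq_constantCoeff_apply,
    sigmaGen, PowerSeries.coeff_mk, PreLambdaRing.σ_zero]
  exact isUnit_one

/-- These are Newton's identities, carried to `R` by the ring homomorphism `f ↦ f ∘ a`. -/
theorem X_mul_derivative_sigmaGen (a : R) :
    PowerSeries.X * PowerSeries.derivative R (sigmaGen a) = adamsGen a * sigmaGen a := by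
  ext n
  have h := congrArg (circHom a) (newton_hSymm n)
  rw [map_mul, map_sum, map_natCast, circHom_apply, circ_hSymm] at h
  trans (n : R) * PreLambdaRing.σ n a
  · cases n with
    | zero => simp
    | succ n =>
      rw [PowerSeries.coeff_succ_X_mul, PowerSeries.coeff_derivative, sigmaGen,
        PowerSeries.coeff_mk]
      push_cast
      ring
  · rw [h, PowerSeries.coeff_mul]
    refine sum_congr rfl fun ij _ => ?_
    rw [map_mul, circHom_apply _ (hSymm _), circ_hSymm, adamsGen, sigmaGen, PowerSeries.coeff_mk,
      PowerSeries.coeff_mk]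
    split_ifs
    · rw [map_zero]
    · rfl

/-- `σ_t` turns sums into products and the logarithmic derivative turns these back into sums. Only
the unit `σ_t(a + b)` is cancelled, so no denominators occur. -/
theorem adamsGen_add (a b : R) : adamsGen (a + b) = adamsGen a + adamsGen b := by
  refine (isUnit_sigmaGen (a + b)).mul_right_cancel ?_
  rw [← X_mul_derivative_sigmaGen, sigmaGen_add, Derivation.leibniz, smul_eq_mul, smul_eq_mul]
  linear_combination sigmaGen a * X_mul_derivative_sigmaGen b +
    sigmaGen b * X_mul_derivative_sigmaGen a

/-- The Adams operation `ψₙ`, for `n ≥ 1`, as an additive map. -/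
noncomputable def adamsHom (R : Type*) [CommRing R] [PreLambdaRing R] {n : ℕ} (hn : n ≠ 0) :
    R →+ R :=
  AddMonoidHom.mk' (circ (pSum n)) fun a b => by
    have h := congrArg (PowerSeries.coeff n) (adamsGen_add a b)
    rw [map_add] at h
    simpa only [adamsGen, PowerSeries.coeff_mk, if_neg hn] using h

theorem circ_pSum_zsmul {n : ℕ} (hn : n ≠ 0) (c : ℤ) (a : R) :
    circ (pSum n) (c • a) = c • circ (pSum n) a :=
  map_zsmul (adamsHom R hn) c a

/-- Here `σ_t(1) = 1/(1 - t)`, whose logarithmic derivative is `t/(1 - t)`. -/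
theorem adamsGen_one_int : adamsGen (1 : ℤ) = PowerSeries.mk fun n => if n = 0 then 0 else 1 := by
  have h1 : sigmaGen (1 : ℤ) = PowerSeries.mk fun _ => 1 := by
    ext n
    rw [sigmaGen, PowerSeries.coeff_mk, PowerSeries.coeff_mk]
    change (-1) ^ n * Ring.choose (-1 : ℤ) n = 1
    rw [Ring.choose_neg, add_sub_cancel_left, Ring.choose_natCast, Nat.choose_self,
      Units.smul_def, Int.negOnePow_def, smul_eq_mul, zpow_natCast, Units.val_pow_eq_pow_val,
      Units.val_neg, Units.val_one, Nat.cast_one, mul_one, ← mul_pow]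
    simp
  refine (isUnit_sigmaGen (1 : ℤ)).mul_right_cancel ?_
  rw [← X_mul_derivative_sigmaGen, h1]
  ext n
  conv_rhs => rw [PowerSeries.coeff_mul]
  simp only [PowerSeries.coeff_mk, mul_one]
  rw [Nat.sum_antidiagonal_eq_sum_range_succ_mk]
  cases n with
  | zero => simp
  | succ n =>
    rw [sum_range_succ', PowerSeries.coeff_succ_X_mul, PowerSeries.coeff_derivative]
    simp

theorem circ_pSum_int {n : ℕ} (hn : n ≠ 0) (c : ℤ) : circ (pSum n) c = c := by
  have h := congrArg (PowerSeries.coeff n) adamsGen_one_int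
  simp only [adamsGen, PowerSeries.coeff_mk, if_neg hn] at h
  have h2 := circ_pSum_zsmul hn c (1 : ℤ)
  rw [h] at h2
  simpa using h2

end adams

/-! ### The logarithmic derivative of `Exp`. -/

section logDeriv
variable {R : Type*} [CommRing R]

theorem constantCoeff_monomial_of_ne {m : ℕ →₀ ℕ} (hm : m ≠ 0) (r : R) :
    MvPowerSeries.constantCoeff (MvPowerSeries.monomial m r) = 0 := by
  classical
  rw [← MvPowerSeries.coeff_zero_eq_constantCoeff_apply, MvPowerSeries.coeff_monomial,
    if_neg hm.symm]

theorem coeff_nsmul_subst_monomial (f : PowerSeries R) {m : ℕ →₀ ℕ} (hm : m ≠ 0) (j : ℕ) :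
    MvPowerSeries.coeff (j • m) (f.subst (MvPowerSeries.monomial m (1 : R))) =
      PowerSeries.coeff j f := by
  classical
  rw [PowerSeries.coeff_subst (.of_constantCoeff_zero (constantCoeff_monomial_of_ne hm 1)),
    finsum_eq_single _ j]
  · rw [MvPowerSeries.monomial_pow, MvPowerSeries.coeff_monomial_same]
    simp
  · intro d hd
    rw [MvPowerSeries.monomial_pow, MvPowerSeries.coeff_monomial, if_neg, smul_zero]
    exact fun h => hd (nsmul_left_injective_of_ne_zero hm h.symm)

theorem coeff_subst_monomial_of_not_exists (f : PowerSeries R) {m M : ℕ →₀ ℕ} (hm : m ≠ 0)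
    (h : ¬ ∃ j : ℕ, M = j • m) :
    MvPowerSeries.coeff M (f.subst (MvPowerSeries.monomial m (1 : R))) = 0 := by
  classical
  rw [PowerSeries.coeff_subst (.of_constantCoeff_zero (constantCoeff_monomial_of_ne hm 1)),
    finsum_eq_zero_of_forall_eq_zero]
  intro d
  rw [MvPowerSeries.monomial_pow, MvPowerSeries.coeff_monomial, if_neg, smul_zero]
  exact fun h' => h ⟨d, h'⟩

theorem euler_monomial (m : ℕ →₀ ℕ) :
    euler R (MvPowerSeries.monomial m (1 : R)) =
      (m.degree : R) • MvPowerSeries.monomial m (1 : R) := by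
  classical
  ext M
  rw [coeff_euler, MvPowerSeries.coeff_smul, MvPowerSeries.coeff_monomial]
  split_ifs with h
  · rw [h]
  · rw [mul_zero, mul_zero]

variable [PreLambdaRing R]

/-- Writing the factor as `σ_t(cₘ)` at `t = x^m` makes the chain rule applicable. -/
theorem expFactor_eq_subst (F : MvPowerSeries ℕ R) {m : ℕ →₀ ℕ} (hm : m ≠ 0) :
    expFactor F m =
      (sigmaGen (MvPowerSeries.coeff m F)).subst (MvPowerSeries.monomial m (1 : R)) := by
  ext M
  by_cases h : ∃ j : ℕ, M = j • m
  · obtain ⟨j, rfl⟩ := h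
    rw [coeff_nsmul_expFactor F hm, coeff_nsmul_subst_monomial _ hm, sigmaGen,
      PowerSeries.coeff_mk]
  · rw [coeff_expFactor_of_not_exists F h, coeff_subst_monomial_of_not_exists _ hm h]

/-- The logarithmic derivative `|m| ∑_{j ≥ 1} ψⱼ(cₘ) x^(j m)` of a factor of `Exp(∑ₘ cₘ x^m)`. -/
noncomputable def logDerivFactor (F : MvPowerSeries ℕ R) (m : ℕ →₀ ℕ) : MvPowerSeries ℕ R :=
  (m.degree : R) •
    (adamsGen (MvPowerSeries.coeff m F)).subst (MvPowerSeries.monomial m (1 : R))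

theorem euler_expFactor {F : MvPowerSeries ℕ R} (hF : MvPowerSeries.coeff 0 F = 0)
    (m : ℕ →₀ ℕ) : euler R (expFactor F m) = expFactor F m * logDerivFactor F m := by
  -- For `m = 0` the substitution `t = 1` has no meaning, but the factor `|m| = 0` in
  -- `logDerivFactor` removes it.
  by_cases hm : m = 0
  · subst hm
    rw [expFactor_of_coeff_eq_zero hF, Derivation.map_one_eq_zero, logDerivFactor, map_zero,
      Nat.cast_zero, zero_smul, mul_zero]
  have h0 := constantCoeff_monomial_of_ne hm (1 : R)
  have hs := PowerSeries.HasSubst.of_constantCoeff_zero h0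
  have h := congrArg (PowerSeries.substAlgHom hs)
    (X_mul_derivative_sigmaGen (MvPowerSeries.coeff m F))
  rw [map_mul, map_mul, PowerSeries.substAlgHom_X, PowerSeries.coe_substAlgHom] at h
  rw [logDerivFactor, expFactor_eq_subst F hm, euler_subst h0, euler_monomial,
    mul_smul_comm, mul_smul_comm, mul_comm, h, mul_comm]

theorem euler_prod_expFactor {F : MvPowerSeries ℕ R} (hF : MvPowerSeries.coeff 0 F = 0)
    (s : Finset (ℕ →₀ ℕ)) :
    euler R (∏ m ∈ s, expFactor F m) =
      (∏ m ∈ s, expFactor F m) * ∑ m ∈ s, logDerivFactor F m := by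
  classical
  induction s using Finset.induction_on with
  | empty => rw [prod_empty, sum_empty, mul_zero, Derivation.map_one_eq_zero]
  | insert a s ha ih =>
    rw [prod_insert ha, sum_insert ha, Derivation.leibniz, ih, euler_expFactor hF, smul_eq_mul,
      smul_eq_mul]
    ring

/-- The logarithmic derivative of `Exp(F)`. -/
noncomputable def logDeriv (F : MvPowerSeries ℕ R) : MvPowerSeries ℕ R :=
  ofCoeffs fun M => ∑ m ∈ Iic M, MvPowerSeries.coeff M (logDerivFactor F m)

/-- Only the multiples `j m` with `j ≥ 1` occur, as `adamsGen` has no constant term; this makes the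
infinite sum over `m` locally finite. -/
theorem coeff_logDerivFactor_of_not_le (F : MvPowerSeries ℕ R) {m M : ℕ →₀ ℕ} (h : ¬ m ≤ M) :
    MvPowerSeries.coeff M (logDerivFactor F m) = 0 := by
  have hm : m ≠ 0 := by
    rintro rfl
    exact h zero_le
  rw [logDerivFactor, MvPowerSeries.coeff_smul]
  by_cases h' : ∃ j : ℕ, M = j • m
  · obtain ⟨j, rfl⟩ := h'
    have hj : j = 0 := by
      by_contra hj
      exact h (le_self_nsmul zero_le hj)
    rw [coeff_nsmul_subst_monomial _ hm, adamsGen, PowerSeries.coeff_mk, if_pos hj, mul_zero]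
  · rw [coeff_subst_monomial_of_not_exists _ hm h', mul_zero]

theorem coeff_sum_logDerivFactor (F : MvPowerSeries ℕ R) {M : ℕ →₀ ℕ} {s : Finset (ℕ →₀ ℕ)}
    (hs : Iic M ⊆ s) :
    MvPowerSeries.coeff M (∑ m ∈ s, logDerivFactor F m) = MvPowerSeries.coeff M (logDeriv F) := by
  rw [logDeriv, coeff_ofCoeffs, map_sum]
  refine (sum_subset hs fun m _ hm => coeff_logDerivFactor_of_not_le F ?_).symm
  rwa [mem_Iic] at hm

/-- The coefficient at `M` sees only the finite product over `Iic M`, and the same product serves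
for both members of any splitting `M = a + b`. -/
theorem euler_expSeries {F : MvPowerSeries ℕ R} (hF : MvPowerSeries.coeff 0 F = 0) :
    euler R (expSeries F) = expSeries F * logDeriv F := by
  classical
  ext M
  rw [coeff_euler, coeff_expSeries hF subset_rfl, ← coeff_euler, euler_prod_expFactor hF,
    MvPowerSeries.coeff_mul, MvPowerSeries.coeff_mul]
  refine sum_congr rfl fun ab hab => ?_
  rw [HasAntidiagonal.mem_antidiagonal] at hab
  rw [coeff_expSeries hF (Iic_subset_Iic.2 (hab ▸ le_self_add)),
    coeff_sum_logDerivFactor F (Iic_subset_Iic.2 (hab ▸ le_add_self))]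

theorem coeff_zero_logDeriv (F : MvPowerSeries ℕ R) : MvPowerSeries.coeff 0 (logDeriv F) = 0 := by
  rw [logDeriv, coeff_ofCoeffs]
  refine sum_eq_zero fun m hm => ?_
  rw [mem_Iic, nonpos_iff_eq_zero] at hm
  rw [hm, logDerivFactor, map_zero, Nat.cast_zero, zero_smul, map_zero]

end logDeriv

/-! ### Primitive exponents. -/

section content

/-- An exponent that is not a proper multiple of another one. -/
def IsPrimitive (m : ℕ →₀ ℕ) : Prop :=
  m ≠ 0 ∧ ∀ (j i : ℕ) (n : ℕ →₀ ℕ), j ≠ 0 → j • n = i • m → ∃ k : ℕ, n = k • m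

theorem exists_eq_nsmul_isPrimitive {M : ℕ →₀ ℕ} (hM : M ≠ 0) :
    ∃ (g : ℕ) (m : ℕ →₀ ℕ), g ≠ 0 ∧ IsPrimitive m ∧ M = g • m := by
  obtain ⟨v, hv⟩ := Finsupp.support_nonempty_iff.2 hM
  obtain ⟨f, hf, hgcd⟩ := M.support.extract_gcd M ⟨v, hv⟩
  set g := M.support.gcd M with hg
  have hg0 : g ≠ 0 := fun h => by
    have := hf v hv
    rw [h, zero_mul] at this
    exact (Finsupp.mem_support_iff.1 hv) this
  have hM' : M = g • Finsupp.indicator M.support (fun i _ => f i) := by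
    ext i
    rw [Finsupp.smul_apply, Finsupp.indicator_apply]
    split_ifs with h
    · exact hf i h
    · rw [smul_zero]
      exact Finsupp.notMem_support_iff.1 h
  refine ⟨g, Finsupp.indicator M.support (fun i _ => f i), hg0, ⟨?_, ?_⟩, hM'⟩
  · intro h
    rw [h, smul_zero] at hM'
    exact hM hM'
  · intro j i n hj h
    have happ : ∀ w, j * n w = i * if w ∈ M.support then f w else 0 := fun w => by
      have := DFunLike.congr_fun h w
      rw [Finsupp.smul_apply, Finsupp.smul_apply, Finsupp.indicator_apply] at this
      simpa using this
    have hji : j ∣ i := by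
      -- The entries `f w` have gcd `1`, so a common divisor of all `i * f w` divides `i`.
      have h2 : j ∣ M.support.gcd fun w => i * f w := by
        refine dvd_gcd fun w hw => ⟨n w, ?_⟩
        have := happ w
        rw [if_pos hw] at this
        exact this.symm
      rw [Finset.gcd_mul_left, hgcd, mul_one] at h2
      simpa using h2
    obtain ⟨k, rfl⟩ := hji
    refine ⟨k, ?_⟩
    ext w
    have := happ w
    rw [mul_assoc] at this
    rw [Finsupp.smul_apply, Finsupp.indicator_apply, Nat.eq_of_mul_eq_mul_left (by omega) this]
    simp

/-- This turns sums over exponents that have `g • m` as a multiple into sums over divisors of `g`.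
-/
theorem IsPrimitive.dvd {m n : ℕ →₀ ℕ} (hm : IsPrimitive m) {j g : ℕ} (hg : g ≠ 0)
    (h : j • n = g • m) : j ≠ 0 ∧ ∃ k : ℕ, n = k • m ∧ j * k = g := by
  have hj : j ≠ 0 := by
    rintro rfl
    rw [zero_nsmul] at h
    refine hg (nsmul_left_injective_of_ne_zero hm.1 ?_)
    simp only
    rw [← h, zero_nsmul]
  obtain ⟨k, rfl⟩ := hm.2 j g n hj h
  refine ⟨hj, k, rfl, nsmul_left_injective_of_ne_zero hm.1 ?_⟩
  simp only
  rw [mul_nsmul', h]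

end content

/-! ### The logarithmic derivative of `Exp` as a Dirichlet convolution. -/

section logDeriv
variable {R : Type*} [CommRing R] [PreLambdaRing R]

/-- The factor at a nonzero `n` contributes to `x^(g m)` only if `n = k m` with `j k = g`, and then
through `ψⱼ`. -/
theorem coeff_nsmul_logDeriv (F : MvPowerSeries ℕ R) {m : ℕ →₀ ℕ} (hm : IsPrimitive m) {g : ℕ}
    (hg : g ≠ 0) :
    MvPowerSeries.coeff (g • m) (logDeriv F) = ∑ ij ∈ g.divisorsAntidiagonal,
      circ (pSum ij.1) (MvPowerSeries.coeff (ij.2 • m) F) * ((ij.2 • m).degree : R) := by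
  have hne : ∀ ij ∈ g.divisorsAntidiagonal, ij.1 ≠ 0 ∧ ij.2 ≠ 0 ∧ ij.1 * ij.2 = g := by
    intro ij hij
    rw [Nat.mem_divisorsAntidiagonal] at hij
    refine ⟨?_, ?_, hij.1⟩ <;> intro h0 <;> rw [h0] at hij <;> simp at hij <;> omega
  rw [logDeriv, coeff_ofCoeffs]
  symm
  refine sum_of_injOn (fun ij => ij.2 • m) ?_ ?_ ?_ ?_
  · intro ij hij kl hkl h
    have h2 : ij.2 = kl.2 := nsmul_left_injective_of_ne_zero hm.1 h
    obtain ⟨_, h3, h4⟩ := hne ij hij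
    obtain ⟨_, _, h5⟩ := hne kl hkl
    refine Prod.ext (Nat.eq_of_mul_eq_mul_right (Nat.pos_of_ne_zero h3) ?_) h2
    rw [h4, h2, h5]
  · intro ij hij
    obtain ⟨h1, _, h3⟩ := hne ij hij
    rw [mem_coe, mem_Iic, ← h3, mul_nsmul']
    exact le_self_nsmul zero_le h1
  · intro n hn hnot
    by_cases hn0 : n = 0
    · rw [hn0, logDerivFactor, map_zero, Nat.cast_zero, zero_smul, map_zero]
    rw [logDerivFactor, MvPowerSeries.coeff_smul, coeff_subst_monomial_of_not_exists _ hn0,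
      mul_zero]
    rintro ⟨j, hj⟩
    obtain ⟨_, k, hk, hjk⟩ := hm.dvd hg hj.symm
    refine hnot ⟨(j, k), ?_, hk.symm⟩
    rw [mem_coe, Nat.mem_divisorsAntidiagonal]
    exact ⟨hjk, hg⟩
  · intro ij hij
    obtain ⟨h1, h2, h3⟩ := hne ij hij
    have h4 : ij.2 • m ≠ 0 := fun h => h2 (nsmul_left_injective_of_ne_zero hm.1 (by simpa using h))
    rw [logDerivFactor, MvPowerSeries.coeff_smul, ← h3, mul_nsmul',
      coeff_nsmul_subst_monomial _ h4, adamsGen, PowerSeries.coeff_mk, if_neg h1, mul_comm]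

end logDeriv

/-! ### The series `log(1 + p_k)`. -/

section powerSums
variable {A : Type*} [CommRing A]

open Classical in
theorem coeff_pIn (k : ℕ) (m : ℕ →₀ ℕ) :
    MvPowerSeries.coeff m (pIn A k) = if ∃ i, m = Finsupp.single i k then 1 else 0 := by
  rw [pIn, MvPowerSeries.coeff_map]
  change Int.castRingHom A (cf m (pSum k)) = _
  rw [cf_pSum]
  split_ifs <;> simp

theorem constantCoeff_pIn {k : ℕ} (hk : k ≠ 0) :
    MvPowerSeries.constantCoeff (pIn A k) = 0 := by
  rw [← MvPowerSeries.coeff_zero_eq_constantCoeff_apply, coeff_pIn, if_neg]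
  rintro ⟨i, hi⟩
  exact hk (Finsupp.single_eq_zero.1 hi.symm)

theorem coeff_expand_of_not_exists {k : ℕ} (hk : k ≠ 0) (F : MvPowerSeries ℕ A) {m : ℕ →₀ ℕ}
    (h : ¬ ∃ n, m = k • n) : MvPowerSeries.coeff m (MvPowerSeries.expand k hk F) = 0 := by
  by_cases h' : ∃ i, ¬ k ∣ m i
  · obtain ⟨i, hi⟩ := h'
    exact MvPowerSeries.coeff_expand_of_not_dvd k hk F hi
  · push Not at h'
    refine absurd ⟨m.mapRange (· / k) (Nat.zero_div k), ?_⟩ h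
    ext i
    rw [Finsupp.smul_apply, Finsupp.mapRange_apply, smul_eq_mul, Nat.mul_div_cancel' (h' i)]

theorem pIn_eq_expand {k : ℕ} (hk : k ≠ 0) : pIn A k = MvPowerSeries.expand k hk (pIn A 1) := by
  classical
  ext m
  by_cases h : ∃ n, m = k • n
  · obtain ⟨n, rfl⟩ := h
    rw [MvPowerSeries.coeff_expand_smul, coeff_pIn, coeff_pIn]
    have : (∃ i, k • n = Finsupp.single i k) ↔ ∃ i, n = Finsupp.single i 1 := by
      refine exists_congr fun i => ?_
      have h1 : Finsupp.single i k = k • Finsupp.single i 1 := by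
        rw [Finsupp.smul_single, smul_eq_mul, mul_one]
      rw [h1]
      exact nsmul_right_inj hk
    simp only [this]
  · rw [coeff_expand_of_not_exists hk _ h, coeff_pIn, if_neg]
    rintro ⟨i, rfl⟩
    refine h ⟨Finsupp.single i 1, ?_⟩
    rw [Finsupp.smul_single, smul_eq_mul, mul_one]

theorem euler_expand {k : ℕ} (hk : k ≠ 0) (F : MvPowerSeries ℕ A) :
    euler A (MvPowerSeries.expand k hk F) =
      (k : A) • MvPowerSeries.expand k hk (euler A F) := by
  ext m
  rw [MvPowerSeries.coeff_smul, coeff_euler]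
  by_cases h : ∃ n, m = k • n
  · obtain ⟨n, rfl⟩ := h
    rw [MvPowerSeries.coeff_expand_smul, MvPowerSeries.coeff_expand_smul, coeff_euler, map_nsmul,
      smul_eq_mul]
    push_cast
    ring
  · rw [coeff_expand_of_not_exists hk _ h, coeff_expand_of_not_exists hk _ h, mul_zero, mul_zero]

theorem isUnit_one_add {u : MvPowerSeries ℕ A} (hu : MvPowerSeries.constantCoeff u = 0) :
    IsUnit (1 + u) := by
  rw [MvPowerSeries.isUnit_iff_constantCoeff, map_add, map_one, hu, add_zero]
  exact isUnit_one

/-- The substitution `xᵢ ↦ xᵢ^k` is a ring homomorphism taking `p₁` to `p_k`. Applying it to the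
equation `(1 + p₁) E log(1 + p₁) = E p₁` and cancelling the unit `1 + p_k` avoids substituting into
the logarithm itself. -/
theorem euler_logOneAdd_pIn [Algebra ℚ A] {k : ℕ} (hk : k ≠ 0) :
    euler A (logOneAdd (pIn A k)) =
      (k : A) • MvPowerSeries.expand k hk (euler A (logOneAdd (pIn A 1))) := by
  refine (isUnit_one_add (constantCoeff_pIn hk)).mul_left_cancel ?_
  rw [one_add_mul_euler_logOneAdd (constantCoeff_pIn hk), pIn_eq_expand hk, mul_smul_comm,
    ← map_one (MvPowerSeries.expand (σ := ℕ) (R := A) k hk), ← map_add, ← map_mul,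
    one_add_mul_euler_logOneAdd (constantCoeff_pIn one_ne_zero), euler_expand]

theorem coeff_nsmul_euler_logOneAdd_pIn [Algebra ℚ A] {k : ℕ} (hk : k ≠ 0) {m : ℕ →₀ ℕ}
    (hm : IsPrimitive m) {g : ℕ} (hg : g ≠ 0) :
    MvPowerSeries.coeff (g • m) (euler A (logOneAdd (pIn A k))) =
      if k ∣ g then k * MvPowerSeries.coeff ((g / k) • m) (euler A (logOneAdd (pIn A 1)))
      else 0 := by
  rw [euler_logOneAdd_pIn hk, MvPowerSeries.coeff_smul]
  split_ifs with h
  · obtain ⟨j, rfl⟩ := h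
    rw [mul_nsmul', MvPowerSeries.coeff_expand_smul,
      Nat.mul_div_cancel_left j (Nat.pos_of_ne_zero hk)]
  · rw [coeff_expand_of_not_exists, mul_zero]
    rintro ⟨n, hn⟩
    obtain ⟨_, j, _, hj⟩ := hm.dvd hg hn.symm
    exact h ⟨j, hj.symm⟩

end powerSums

/-! ### The formula for `Log(1 + p₁)`. -/

section logPSum

/-- The power series `Log(1 + p₁)`. -/
noncomputable abbrev logP : SymSeries ℤ := Log (1 + (pSum 1).1)

theorem coeff_zero_one_add_pSum :
    MvPowerSeries.coeff 0 (1 + (pSum 1).1 : SymSeries ℤ).1 = 1 := by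
  classical
  have h : cf 0 (pSum 1) = 0 := by
    rw [cf_pSum, if_neg]
    rintro ⟨i, hi⟩
    exact one_ne_zero (Finsupp.single_eq_zero.1 hi.symm)
  rw [Subring.coe_add, map_add]
  change MvPowerSeries.coeff 0 1 + cf 0 (pSum 1) = 1
  rw [h, add_zero, MvPowerSeries.coeff_one, if_pos rfl]

theorem logP_mem_filtration : logP.1 ∈ filtration ℤ 1 := Log_mem_filtration coeff_zero_one_add_pSum

theorem Exp_logP : Exp logP = 1 + (pSum 1).1 := Exp_Log coeff_zero_one_add_pSum

theorem coeff_zero_logP : MvPowerSeries.coeff 0 logP.1 = 0 := logP_mem_filtration 0 (by simp)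

theorem euler_map {A B : Type*} [CommRing A] [CommRing B] (f : A →+* B) (F : MvPowerSeries ℕ A) :
    euler B (MvPowerSeries.map f F) = MvPowerSeries.map f (euler A F) := by
  ext m
  rw [coeff_euler, MvPowerSeries.coeff_map, MvPowerSeries.coeff_map, coeff_euler, map_mul,
    map_natCast]

variable (A : Type*) [CommRing A]

/-- Both sides are the logarithmic derivative of `1 + p₁`, computed once through `log` and once
through `Exp(Log(1 + p₁))`. -/
theorem euler_logOneAdd_pIn_one [Algebra ℚ A] :
    euler A (logOneAdd (pIn A 1)) = MvPowerSeries.map (Int.castRingHom A) (logDeriv logP.1) := by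
  have h0 : MvPowerSeries.constantCoeff (pIn A 1) = 0 := constantCoeff_pIn one_ne_zero
  have hE : expSeries logP.1 = 1 + (pSum 1).1.1 := by
    rw [← coe_Exp logP_mem_filtration, Exp_logP]
    rfl
  have h := congrArg (MvPowerSeries.map (Int.castRingHom A)) (euler_expSeries coeff_zero_logP)
  rw [hE, ← euler_map, map_mul, map_add, map_one, map_add, Derivation.map_one_eq_zero,
    zero_add] at h
  refine (isUnit_one_add h0).mul_left_cancel ?_
  rw [one_add_mul_euler_logOneAdd h0]
  exact h

/-- The coefficients of the Euler derivative of `Log(1 + p₁)` at the multiples of an exponent. -/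
noncomputable def eulerLogP (m : ℕ →₀ ℕ) : ArithmeticFunction A :=
  ⟨fun g => MvPowerSeries.coeff (g • m) logP.1 * ((g • m).degree : A), by
    rw [zero_nsmul, map_zero, Nat.cast_zero, mul_zero]⟩

theorem eulerLogP_apply (m : ℕ →₀ ℕ) (g : ℕ) :
    eulerLogP A m g = MvPowerSeries.coeff (g • m) logP.1 * ((g • m).degree : A) := rfl

/-- The Adams operations are trivial on `ℤ`, so the convolution of `coeff_nsmul_logDeriv` is one
with `ζ`. -/
theorem coeff_nsmul_euler_logOneAdd_pIn_one [Algebra ℚ A] {m : ℕ →₀ ℕ} (hm : IsPrimitive m)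
    {g : ℕ} (hg : g ≠ 0) :
    MvPowerSeries.coeff (g • m) (euler A (logOneAdd (pIn A 1))) =
      ((ArithmeticFunction.zeta : ArithmeticFunction A) * eulerLogP A m) g := by
  rw [euler_logOneAdd_pIn_one, MvPowerSeries.coeff_map, coeff_nsmul_logDeriv _ hm hg, map_sum,
    ArithmeticFunction.mul_apply]
  refine sum_congr rfl fun ij hij => ?_
  have h1 : ij.1 ≠ 0 := by
    rintro h0
    rw [Nat.mem_divisorsAntidiagonal, h0, zero_mul] at hij
    exact hij.2 hij.1.symm
  rw [circ_pSum_int h1, ArithmeticFunction.natCoe_apply, ArithmeticFunction.zeta_apply_ne h1,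
    Nat.cast_one, one_mul, eulerLogP_apply, map_mul, map_natCast]
  rfl

variable {A}

/-- The factor `k` in `E log(1 + p_k)` cancels the denominator of `c k`, and the shift from `g` to
`g / k` is a convolution. The bound `N` is at least `g`, so all divisors of `g` are in the range. -/
theorem coeff_nsmul_sum_euler_logOneAdd [Algebra ℚ A] (c : ℕ → A) (a : ArithmeticFunction A)
    (hca : ∀ k, k ≠ 0 → c k * k = a k) {m : ℕ →₀ ℕ} (hm : IsPrimitive m) {g N : ℕ} (hg : g ≠ 0)
    (hN : (g • m).degree ≤ N) :
    MvPowerSeries.coeff (g • m)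
      (∑ k ∈ Icc 1 N, MvPowerSeries.C (c k) * euler A (logOneAdd (pIn A k))) =
      (a * ((ArithmeticFunction.zeta : ArithmeticFunction A) * eulerLogP A m)) g := by
  have hgN : g ≤ N := (degree_nsmul_ge hm.1 g).trans hN
  rw [map_sum, ArithmeticFunction.mul_apply, Nat.sum_divisorsAntidiagonal (fun i j =>
    a i * ((ArithmeticFunction.zeta : ArithmeticFunction A) * eulerLogP A m) j)]
  have hsub : g.divisors ⊆ Icc 1 N := by
    intro k hk
    rw [mem_Icc]
    exact ⟨Nat.pos_of_mem_divisors hk, (Nat.divisor_le hk).trans hgN⟩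
  symm
  refine sum_subset_zero_on_sdiff hsub ?_ ?_
  · intro k hk
    rw [mem_sdiff, mem_Icc, Nat.mem_divisors] at hk
    rw [MvPowerSeries.coeff_C_mul, coeff_nsmul_euler_logOneAdd_pIn (by omega) hm hg, if_neg,
      mul_zero]
    exact fun h => hk.2 ⟨h, hg⟩
  · intro k hk
    have hk0 : k ≠ 0 := (Nat.pos_of_mem_divisors hk).ne'
    have hkg := Nat.dvd_of_mem_divisors hk
    have hgk : g / k ≠ 0 := (Nat.div_pos (Nat.divisor_le hk) (Nat.pos_of_ne_zero hk0)).ne'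
    rw [MvPowerSeries.coeff_C_mul, coeff_nsmul_euler_logOneAdd_pIn hk0 hm hg, if_pos hkg,
      ← mul_assoc, hca k hk0, coeff_nsmul_euler_logOneAdd_pIn_one A hm hgk]

theorem constantCoeff_sum_logOneAdd [Algebra ℚ A] (c : ℕ → A) (N : ℕ) :
    MvPowerSeries.coeff 0
      (∑ k ∈ Icc 1 N, MvPowerSeries.C (c k) * logOneAdd (pIn A k)) = 0 := by
  rw [MvPowerSeries.coeff_zero_eq_constantCoeff_apply, map_sum]
  refine sum_eq_zero fun k hk => ?_
  rw [mem_Icc] at hk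
  rw [map_mul, constantCoeff_logOneAdd (constantCoeff_pIn (by omega)), mul_zero]

/-- The case `a = μ` of `coeff_nsmul_sum_euler_logOneAdd`: since `μ * ζ = 1`, the Euler derivatives
agree, and over `ℚ` the degree can be cancelled. -/
theorem convergesTo_logP :
    ConvergesTo
      (fun N => ∑ n ∈ Finset.Icc 1 N,
        MvPowerSeries.C ((ArithmeticFunction.moebius n : ℚ) / (n : ℚ)) * logOneAdd (pIn ℚ n))
      (MvPowerSeries.map (Int.castRingHom ℚ) logP.1) := by
  intro n
  refine ⟨n, fun N hN M hM => ?_⟩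
  rw [map_sub, sub_eq_zero, MvPowerSeries.coeff_map]
  by_cases hM0 : M = 0
  · rw [hM0, constantCoeff_sum_logOneAdd, coeff_zero_logP, map_zero]
  obtain ⟨g, m, hg, hm, rfl⟩ := exists_eq_nsmul_isPrimitive hM0
  have hd : ((g • m).degree : ℚ) ≠ 0 := by
    rwa [Nat.cast_ne_zero, Ne, Finsupp.degree_eq_zero_iff]
  refine mul_left_cancel₀ hd ?_
  rw [← coeff_euler, map_sum]
  have h1 : ∀ k ∈ Icc 1 N, euler ℚ (MvPowerSeries.C
      ((ArithmeticFunction.moebius k : ℚ) / (k : ℚ)) * logOneAdd (pIn ℚ k)) =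
      MvPowerSeries.C ((ArithmeticFunction.moebius k : ℚ) / (k : ℚ)) *
        euler ℚ (logOneAdd (pIn ℚ k)) := by
    intro k _
    rw [← MvPowerSeries.smul_eq_C_mul, ← MvPowerSeries.smul_eq_C_mul, Derivation.map_smul]
  rw [sum_congr rfl h1, coeff_nsmul_sum_euler_logOneAdd
    (fun k => (ArithmeticFunction.moebius k : ℚ) / (k : ℚ))
    (ArithmeticFunction.moebius : ArithmeticFunction ℚ) _ hm hg (by omega), ← mul_assoc,
    ArithmeticFunction.coe_moebius_mul_coe_zeta, one_mul, eulerLogP_apply, mul_comm]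
  · rfl
  · intro k hk
    rw [ArithmeticFunction.intCoe_apply]
    field_simp

end logPSum

/-! ### The infinite product. -/

section product
variable {R : Type*} [CommRing R]

open scoped TensorProduct

theorem coeff_tmul (F : SymSeries ℤ) (x : R) (m : ℕ →₀ ℕ) :
    MvPowerSeries.coeff m (tmul F x).1 = MvPowerSeries.coeff m F.1 • x := by
  rw [zsmul_eq_mul]
  rfl

theorem moebius_mul_mul_zeta_mul {A : Type*} [CommRing A] (a b : ArithmeticFunction A) :
    ((ArithmeticFunction.moebius : ArithmeticFunction A) * a) *
      ((ArithmeticFunction.zeta : ArithmeticFunction A) * b) = a * b := by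
  rw [mul_mul_mul_comm, ArithmeticFunction.coe_moebius_mul_coe_zeta, one_mul]

theorem tmul_logP_mem_filtration (x : R) : (tmul logP x).1 ∈ filtration R 1 := by
  intro m hm
  rw [coeff_tmul, logP_mem_filtration m hm, zero_smul]

variable [PreLambdaRing R]

/-- The Adams operations `d ↦ ψ_d(x)` as an arithmetic function with values in `ℚ ⊗ R`. -/
noncomputable def adamsFun (x : R) : ArithmeticFunction (ℚ ⊗[ℤ] R) :=
  ⟨fun d => if d = 0 then 0 else (1 : ℚ) ⊗ₜ[ℤ] circ (pSum d) x, if_pos rfl⟩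

theorem adamsFun_apply (x : R) {d : ℕ} (hd : d ≠ 0) :
    adamsFun x d = (1 : ℚ) ⊗ₜ[ℤ] circ (pSum d) x := if_neg hd

/-- The exponents of the product have the shape `a(k)/k` required by
`coeff_nsmul_sum_euler_logOneAdd`, with `a = μ * ψ(x)`. -/
theorem phiExponent_mul (x : R) {k : ℕ} (hk : k ≠ 0) :
    phiExponent k x * (k : ℚ ⊗[ℤ] R) =
      ((ArithmeticFunction.moebius : ArithmeticFunction (ℚ ⊗[ℤ] R)) * adamsFun x) k := by
  rw [phiExponent, ArithmeticFunction.mul_apply, Nat.sum_divisorsAntidiagonal' (fun i j =>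
    (ArithmeticFunction.moebius : ArithmeticFunction (ℚ ⊗[ℤ] R)) i * adamsFun x j), sum_mul]
  refine sum_congr rfl fun d hd => ?_
  have hd0 : d ≠ 0 := (Nat.pos_of_mem_divisors hd).ne'
  have hcast : (k : ℚ ⊗[ℤ] R) = (k : ℚ) ⊗ₜ[ℤ] (1 : R) :=
    (map_natCast (Algebra.TensorProduct.includeLeftRingHom (R := ℤ) (A := ℚ) (B := R)) k).symm
  have hcast' : ∀ z : ℤ, (z : ℚ ⊗[ℤ] R) = (z : ℚ) ⊗ₜ[ℤ] (1 : R) := fun z =>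
    (map_intCast (Algebra.TensorProduct.includeLeftRingHom (R := ℤ) (A := ℚ) (B := R)) z).symm
  rw [adamsFun_apply x hd0, ArithmeticFunction.intCoe_apply, hcast, hcast',
    Algebra.TensorProduct.tmul_mul_tmul, Algebra.TensorProduct.tmul_mul_tmul, mul_one, mul_one,
    one_mul, div_mul_cancel₀ _ (Nat.cast_ne_zero.2 hk)]

theorem euler_phiProd (x : R) (N : ℕ) :
    euler (ℚ ⊗[ℤ] R) (phiProd x N) = phiProd x N * ∑ k ∈ Icc 1 N,
      MvPowerSeries.C (phiExponent k x) * euler (ℚ ⊗[ℤ] R) (logOneAdd (pIn (ℚ ⊗[ℤ] R) k)) := by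
  classical
  have h : ∀ s : Finset ℕ, (∀ k ∈ s, k ≠ 0) → euler (ℚ ⊗[ℤ] R)
      (∏ k ∈ s, oneAddPow (pIn (ℚ ⊗[ℤ] R) k) (phiExponent k x)) =
      (∏ k ∈ s, oneAddPow (pIn (ℚ ⊗[ℤ] R) k) (phiExponent k x)) * ∑ k ∈ s,
        MvPowerSeries.C (phiExponent k x) *
          euler (ℚ ⊗[ℤ] R) (logOneAdd (pIn (ℚ ⊗[ℤ] R) k)) := by
    intro s hs
    induction s using Finset.induction_on with
    | empty => rw [prod_empty, sum_empty, mul_zero, Derivation.map_one_eq_zero]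
    | insert a s ha ih =>
      rw [prod_insert ha, sum_insert ha, Derivation.leibniz,
        ih fun k hk => hs k (mem_insert_of_mem hk),
        euler_oneAddPow (constantCoeff_pIn (hs a (mem_insert_self a s))), smul_eq_mul,
        smul_eq_mul]
      ring
  exact h _ fun k hk => by
    rw [mem_Icc] at hk
    omega

/-- Both sides have constant term `1`, and by `(μ * ψ(x)) * (ζ * L) = ψ(x) * L` their logarithmic
derivatives agree up to degree `N`. -/
theorem convergesTo_phiProd (x : R) : ConvergesTo (phiProd x) (toRat (Exp (tmul logP x))) := by
  have hF0 : MvPowerSeries.coeff 0 (tmul logP x).1 = 0 := tmul_logP_mem_filtration x 0 (by simp)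
  intro n
  refine ⟨n, fun N hN M hM => ?_⟩
  rw [map_sub, sub_eq_zero, toRat, coe_Exp (tmul_logP_mem_filtration x)]
  refine coeff_eq_of_euler_eq (N := N)
    (W := MvPowerSeries.map (Algebra.TensorProduct.includeRight (R := ℤ) (A := ℚ) (B := R)).toRingHom
      (logDeriv (tmul logP x).1)) (euler_phiProd x N) ?_ ?_ ?_ ?_ (by omega)
  · rw [euler_map, euler_expSeries hF0, map_mul]
  · intro m hmN
    by_cases hm0 : m = 0
    · rw [hm0, MvPowerSeries.coeff_map, coeff_zero_logDeriv, map_zero, map_sum]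
      refine sum_eq_zero fun k _ => ?_
      rw [MvPowerSeries.coeff_C_mul, coeff_euler, map_zero, Nat.cast_zero, zero_mul, mul_zero]
    obtain ⟨g, m, hg, hm, rfl⟩ := exists_eq_nsmul_isPrimitive hm0
    rw [coeff_nsmul_sum_euler_logOneAdd (fun k => phiExponent k x) _
      (fun k hk => phiExponent_mul x hk) hm hg hmN, MvPowerSeries.coeff_map,
      coeff_nsmul_logDeriv _ hm hg, map_sum]
    have hring : ((ArithmeticFunction.moebius : ArithmeticFunction (ℚ ⊗[ℤ] R)) * adamsFun x) *
        ((ArithmeticFunction.zeta : ArithmeticFunction (ℚ ⊗[ℤ] R)) *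
          eulerLogP (ℚ ⊗[ℤ] R) m) = adamsFun x * eulerLogP (ℚ ⊗[ℤ] R) m :=
      moebius_mul_mul_zeta_mul _ _
    rw [hring, ArithmeticFunction.mul_apply]
    refine sum_congr rfl fun ij hij => ?_
    have h1 : ij.1 ≠ 0 := by
      rintro h0
      rw [Nat.mem_divisorsAntidiagonal, h0, zero_mul] at hij
      exact hij.2 hij.1.symm
    -- The coefficients of `Log(1 + p₁)` are integers, so `ψᵢ` passes through them to `x`.
    rw [coeff_tmul, circ_pSum_zsmul h1, adamsFun_apply x h1, eulerLogP_apply, map_mul,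
      map_natCast, map_zsmul, zsmul_eq_mul, ← mul_assoc, mul_comm ((1 : ℚ) ⊗ₜ[ℤ] circ (pSum ij.1) x)]
    rfl
  · rw [MvPowerSeries.coeff_map, coeff_zero_logDeriv, map_zero]
  · rw [MvPowerSeries.coeff_map, coeff_zero_expSeries, map_one,
      MvPowerSeries.coeff_zero_eq_constantCoeff_apply, phiProd, map_prod]
    refine prod_eq_one fun k hk => ?_
    rw [mem_Icc] at hk
    exact constantCoeff_oneAddPow (constantCoeff_pIn (by omega)) _

end product

/-! ### Products of complete symmetric functions. -/

section completeProducts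

/-- The product of the complete symmetric functions `hₙ`, for `n` in a multiset. -/
noncomputable def hProd (s : Multiset ℕ) : SymFun := (s.map hSymm).prod

theorem isHomog_hSymm (n : ℕ) : IsHomog n (hSymm n) := by
  intro m hm
  rw [cf_hSymm] at hm
  by_contra h
  exact hm (if_neg h)

theorem isHomog_hProd (s : Multiset ℕ) : IsHomog s.sum (hProd s) := by
  induction s using Multiset.induction_on with
  | empty => simpa [hProd] using IsHomog.one
  | cons a s ih =>
    rw [hProd, Multiset.map_cons, Multiset.prod_cons, Multiset.sum_cons]
    exact (isHomog_hSymm a).mul ih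

/-- The additive group of the symmetric functions that are homogeneous of degree `n`. -/
noncomputable def homogSubmodule (n : ℕ) : Submodule ℤ SymFun where
  carrier := {f | IsHomog n f}
  zero_mem' m hm := absurd (map_zero (cfHom m)) hm
  add_mem' {f g} hf hg m hm := by
    by_contra h
    have h1 : cfHom m f = 0 := not_not.1 fun h' => h (hf m h')
    have h2 : cfHom m g = 0 := not_not.1 fun h' => h (hg m h')
    exact hm ((map_add (cfHom m) f g).trans (by rw [h1, h2, add_zero]))
  smul_mem' c f hf m hm := by
    by_contra h
    have h1 : cfHom m f = 0 := not_not.1 fun h' => h (hf m h')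
    exact hm ((map_zsmul (cfHom m) c f).trans (by rw [h1, smul_zero]))

/-- Since `h₀ = 1`, zero indices, which do occur in the Jacobi–Trudi expansion, may be dropped to
obtain a partition. -/
theorem hProd_filter (s : Multiset ℕ) : hProd (s.filter (· ≠ 0)) = hProd s := by
  induction s using Multiset.induction_on with
  | empty => rfl
  | cons a s ih =>
    by_cases ha : a = 0
    · rw [Multiset.filter_cons_of_neg (p := (· ≠ 0)) _ (not_not.2 ha), ih, hProd, hProd, Multiset.map_cons,
        Multiset.prod_cons, ha, hSymm_zero, one_mul]
    · rw [Multiset.filter_cons_of_pos (p := (· ≠ 0)) _ ha, hProd, hProd, Multiset.map_cons, Multiset.prod_cons,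
        Multiset.map_cons, Multiset.prod_cons, ← hProd, ← hProd, ih]

/-- The sum of the squares of the entries of a multiset. -/
def sqSum (s : Multiset ℕ) : ℕ := (s.map (· ^ 2)).sum

theorem sqSum_filter (s : Multiset ℕ) : sqSum (s.filter (· ≠ 0)) = sqSum s := by
  induction s using Multiset.induction_on with
  | empty => rfl
  | cons a s ih =>
    by_cases ha : a = 0
    · rw [Multiset.filter_cons_of_neg (p := (· ≠ 0)) _ (not_not.2 ha), ih, sqSum, sqSum, Multiset.map_cons,
        Multiset.sum_cons, ha]
      simp
    · rw [Multiset.filter_cons_of_pos (p := (· ≠ 0)) _ ha, sqSum, sqSum, Multiset.map_cons, Multiset.sum_cons,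
        Multiset.map_cons, Multiset.sum_cons, ← sqSum, ← sqSum, ih]

/-- This bound makes the upward induction on the sum of squares terminate. -/
theorem sqSum_le (s : Multiset ℕ) : sqSum s ≤ s.sum ^ 2 := by
  induction s using Multiset.induction_on with
  | empty => exact Nat.zero_le _
  | cons a s ih =>
    rw [sqSum, Multiset.map_cons, Multiset.sum_cons, Multiset.sum_cons, ← sqSum]
    nlinarith [Nat.zero_le (a * s.sum)]

theorem mem_span_hProd (f : SymFun) : f ∈ Submodule.span ℤ (Set.range hProd) := by
  obtain ⟨P, rfl⟩ := polyH_bijective.2 f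
  induction P using MvPolynomial.induction_on with
  | C a =>
    have h : polyH (MvPolynomial.C a) = a • hProd 0 := by
      rw [← MvPolynomial.algebraMap_eq, AlgHom.commutes, hProd, Multiset.map_zero,
        Multiset.prod_zero, Algebra.algebraMap_eq_smul_one]
    rw [h]
    exact Submodule.smul_mem _ _ (Submodule.subset_span ⟨0, rfl⟩)
  | add p q hp hq =>
    rw [map_add]
    exact Submodule.add_mem _ hp hq
  | mul_X p i hp =>
    rw [map_mul, polyH, MvPolynomial.aeval_X, ← polyH]
    refine Submodule.span_induction (p := fun f _ =>
      f * hSymm (i + 1) ∈ Submodule.span ℤ (Set.range hProd)) ?_ ?_ ?_ ?_ hp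
    · rintro _ ⟨s, rfl⟩
      refine Submodule.subset_span ⟨(i + 1) ::ₘ s, ?_⟩
      rw [hProd, Multiset.map_cons, Multiset.prod_cons, mul_comm, ← hProd]
    · rw [zero_mul]
      exact Submodule.zero_mem _
    · intro f g _ _ hf hg
      rw [add_mul]
      exact Submodule.add_mem _ hf hg
    · intro c f _ hf
      rw [smul_mul_assoc]
      exact Submodule.smul_mem _ _ hf

end completeProducts

/-! ### Triangularity of the Jacobi–Trudi determinant. -/

section jacobiTrudi

theorem perm_eq_one_of_monotone {l : ℕ} {σ : Equiv.Perm (Fin l)} (h : Monotone σ) : σ = 1 := by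
  have h1 : StrictMono σ := h.strictMono_of_injective σ.injective
  exact Equiv.ext fun i => by
    have := congrArg (fun e : Fin l ≃o Fin l => e i)
      (Subsingleton.elim (h1.orderIsoOfSurjective σ σ.surjective) (OrderIso.refl _))
    simpa using this

/-- Permuting `a` leaves `∑ a i ^ 2` unchanged, so only the cross term `∑ a (σ i) * i` matters. By
the rearrangement inequality it is least for oppositely ordered sequences, strictly so as the only
monotone permutation is the identity. -/
theorem sum_sq_lt_sum_sq_comp_perm {l : ℕ} {a : Fin l → ℤ} (ha : StrictAnti a)
    {σ : Equiv.Perm (Fin l)} (hσ : σ ≠ 1) :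
    ∑ i : Fin l, (a i + (i : ℤ)) ^ 2 < ∑ i : Fin l, (a (σ i) + (i : ℤ)) ^ 2 := by
  have hanti : Antivary a fun i : Fin l => (i : ℤ) := by
    intro i j hij
    exact (ha.antitone (by simpa using hij.le : i ≤ j))
  have h1 : ¬ Antivary (a ∘ σ) fun i : Fin l => (i : ℤ) := by
    intro h
    refine hσ (perm_eq_one_of_monotone fun i j hij => ?_)
    rcases hij.eq_or_lt with rfl | hlt
    · exact le_rfl
    · exact ha.le_iff_ge.1 (h (by simpa using hlt))
  have h2 := hanti.sum_mul_lt_sum_comp_perm_mul_iff.2 h1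
  have h3 : ∑ i, a (σ i) ^ 2 = ∑ i, a i ^ 2 := Equiv.sum_comp σ fun i => a i ^ 2
  simp only [add_sq, sum_add_distrib, h3]
  have h4 : ∀ b : Fin l → ℤ, ∑ i : Fin l, 2 * b i * (i : ℤ) = 2 * ∑ i : Fin l, b i * (i : ℤ) :=
    fun b => by
      rw [mul_sum]
      exact sum_congr rfl fun i _ => mul_assoc _ _ _
  rw [h4, h4 fun i => a (σ i)]
  linarith

theorem prod_hInt {l : ℕ} (b : Fin l → ℤ) :
    ∏ i, hInt (b i) = 0 ∨
      ((∀ i, 0 ≤ b i) ∧ ∏ i, hInt (b i) = hProd ((univ : Finset (Fin l)).val.map fun i => (b i).toNat)) := by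
  by_cases h : ∀ i, 0 ≤ b i
  · refine Or.inr ⟨h, ?_⟩
    rw [hProd, Multiset.map_map]
    refine prod_congr rfl fun i _ => ?_
    obtain ⟨n, hn⟩ := Int.eq_ofNat_of_zero_le (h i)
    simp only [Function.comp_apply, hn, Int.toNat_natCast]
    rfl
  · push Not at h
    obtain ⟨i, hi⟩ := h
    refine Or.inl (prod_eq_zero (mem_univ i) ?_)
    obtain ⟨n, hn⟩ := Int.eq_negSucc_of_lt_zero hi
    rw [hn]
    rfl

/-- A Schur function is the product of the complete symmetric functions of the parts plus a
combination of such products with a greater sum of squares. -/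
theorem schur_sub_hProd_mem {n : ℕ} (lam : n.Partition) :
    schur lam - hProd lam.parts ∈ Submodule.span ℤ
      (hProd '' {s | s.sum = n ∧ sqSum lam.parts < sqSum s}) := by
  classical
  set L := lam.parts.sort (· ≥ ·) with hL
  have hLparts : (L : Multiset ℕ) = lam.parts := Multiset.sort_eq _ _
  have hsorted : L.Pairwise (· ≥ ·) := Multiset.pairwise_sort _ _
  -- The shift makes the weakly decreasing parts strictly decreasing; the term of `σ` in the
  -- determinant then has the indices `a (σ i) + i`.
  let a : Fin L.length → ℤ := fun i => (L.get i : ℤ) - (i : ℤ)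
  have ha : StrictAnti a := by
    intro i j hij
    have h1 : L.get j ≤ L.get i := List.pairwise_iff_get.1 hsorted i j hij
    have h2 : (i : ℕ) < j := hij
    change (L.get j : ℤ) - (j : ℤ) < (L.get i : ℤ) - (i : ℤ)
    omega
  have hmap : ∀ {α : Type} (f : ℕ → α), lam.parts.map f =
      (univ : Finset (Fin L.length)).val.map fun i => f (L.get i) := by
    intro α f
    rw [Fin.univ_val_map, ← hLparts, Multiset.map_coe]
    congr 1
    conv_lhs => rw [← List.ofFn_get L, List.map_ofFn]
    rfl
  have hget : ∀ i, (L.get i : ℤ) = a i + (i : ℤ) := fun i => (sub_add_cancel _ _).symm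
  have hdet : schur lam = ∑ σ : Equiv.Perm (Fin L.length),
      Equiv.Perm.sign σ • ∏ i, hInt (a (σ i) + (i : ℤ)) := by
    rw [schur, Matrix.det_apply]
    rfl
  have hone : ∏ i, hInt (a ((1 : Equiv.Perm (Fin L.length)) i) + (i : ℤ)) = hProd lam.parts := by
    rw [hProd, hmap]
    refine prod_congr rfl fun i _ => ?_
    rw [Equiv.Perm.one_apply, ← hget]
    rfl
  rw [hdet, ← add_sum_erase _ _ (mem_univ 1), Equiv.Perm.sign_one, one_smul, hone,
    add_sub_cancel_left]
  refine Submodule.sum_mem _ fun σ hσ => ?_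
  rw [mem_erase] at hσ
  rw [Units.smul_def]
  refine Submodule.smul_mem _ _ ?_
  -- A term with a negative index vanishes; otherwise its indices have the same sum and, as `σ ≠ 1`,
  -- a greater sum of squares.
  rcases prod_hInt fun i => a (σ i) + (i : ℤ) with h | ⟨hpos, h⟩
  · rw [h]
    exact Submodule.zero_mem _
  · rw [h]
    refine Submodule.subset_span ⟨_, ⟨?_, ?_⟩, rfl⟩
    · have h1 : (∑ i : Fin L.length, L.get i) = n := by
        have := congrArg Multiset.sum (hmap id)
        rw [Multiset.map_id, lam.parts_sum] at this
        exact this.symm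
      change (∑ i, (a (σ i) + (i : ℤ)).toNat) = n
      have h2 : ∑ i, a (σ i) = ∑ i, a i := Equiv.sum_comp σ a
      rw [← h1]
      zify
      rw [sum_congr rfl fun i _ => Int.toNat_of_nonneg (hpos i), sum_congr rfl fun i _ => hget i,
        sum_add_distrib, sum_add_distrib, h2]
    · rw [sqSum, sqSum, hmap, Multiset.map_map]
      change (∑ i : Fin L.length, L.get i ^ 2) < ∑ i, (a (σ i) + (i : ℤ)).toNat ^ 2
      zify
      rw [sum_congr rfl fun i _ => congrArg (· ^ 2) (Int.toNat_of_nonneg (hpos i)),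
        sum_congr rfl fun i _ => congrArg (· ^ 2) (hget i)]
      exact sum_sq_lt_sum_sq_comp_perm ha hσ.1

end jacobiTrudi

/-! ### Schur functions span the symmetric functions. -/

section schurSpan

theorem schur_mem_homogSubmodule {n : ℕ} (lam : n.Partition) : schur lam ∈ homogSubmodule n := by
  have h1 : schur lam - hProd lam.parts ∈ homogSubmodule n := by
    refine Submodule.span_le.2 ?_ (schur_sub_hProd_mem lam)
    rintro _ ⟨s, hs, rfl⟩
    exact hs.1 ▸ isHomog_hProd s
  have h2 : hProd lam.parts ∈ homogSubmodule n := by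
    have := isHomog_hProd lam.parts
    rwa [lam.parts_sum] at this
  have := Submodule.add_mem _ h1 h2
  rwa [sub_add_cancel] at this

/-- Unitriangular inversion: the product is a Schur function minus a combination of products with
greater sum of squares, to which induction on `n ^ 2 - sqSum s` applies. -/
theorem hProd_mem_span_schur (n : ℕ) (s : Multiset ℕ) (hs : s.sum = n) :
    hProd s ∈ Submodule.span ℤ (Set.range (schur : n.Partition → SymFun)) := by
  induction hd : n ^ 2 - sqSum s using Nat.strong_induction_on generalizing s with
  | _ d ih =>
    let lam : n.Partition := Nat.Partition.ofSums n s hs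
    have hparts : lam.parts = s.filter (· ≠ 0) := rfl
    have h1 : hProd s = schur lam - (schur lam - hProd lam.parts) := by
      rw [sub_sub_cancel, hparts, hProd_filter]
    rw [h1]
    refine Submodule.sub_mem _ (Submodule.subset_span ⟨lam, rfl⟩) ?_
    refine Submodule.span_le.2 ?_ (schur_sub_hProd_mem lam)
    rintro _ ⟨t, ⟨ht, hlt⟩, rfl⟩
    rw [hparts, sqSum_filter] at hlt
    have := sqSum_le t
    rw [ht] at this
    exact ih _ (by omega) t ht rfl

/-- The Schur functions of degree `n` span the symmetric functions of degree `n`. -/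
theorem mem_span_schur {n : ℕ} {f : SymFun} (hf : IsHomog n f) :
    f ∈ Submodule.span ℤ (Set.range (schur : n.Partition → SymFun)) := by
  -- The induction over the span passes through inhomogeneous functions, so it tracks only the
  -- component of degree `n`.
  have key : ∃ g ∈ Submodule.span ℤ (Set.range (schur : n.Partition → SymFun)),
      ∀ m : ℕ →₀ ℕ, m.degree = n → cfHom m g = cfHom m f := by
    refine Submodule.span_induction (p := fun f _ =>
      ∃ g ∈ Submodule.span ℤ (Set.range (schur : n.Partition → SymFun)),
        ∀ m : ℕ →₀ ℕ, m.degree = n → cfHom m g = cfHom m f) ?_ ?_ ?_ ?_ (mem_span_hProd f)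
    · rintro _ ⟨s, rfl⟩
      by_cases hs : s.sum = n
      · exact ⟨_, hProd_mem_span_schur n s hs, fun _ _ => rfl⟩
      · refine ⟨0, Submodule.zero_mem _, fun m hm => ?_⟩
        rw [map_zero]
        by_contra h
        exact hs (hm ▸ (isHomog_hProd s m (Ne.symm h)).symm)
    · exact ⟨0, Submodule.zero_mem _, fun _ _ => rfl⟩
    · rintro f f' _ _ ⟨g, hg, h⟩ ⟨g', hg', h'⟩
      exact ⟨g + g', Submodule.add_mem _ hg hg', fun m hm => by
        rw [map_add, map_add, h m hm, h' m hm]⟩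
    · rintro c f _ ⟨g, hg, h⟩
      exact ⟨c • g, Submodule.smul_mem _ _ hg, fun m hm => by
        rw [map_zsmul, map_zsmul, h m hm]⟩
  obtain ⟨g, hg, h⟩ := key
  have hgn : g ∈ homogSubmodule n := by
    refine Submodule.span_le.2 ?_ hg
    rintro _ ⟨lam, rfl⟩
    exact schur_mem_homogSubmodule lam
  have hfg : f = g := cf_ext fun m => by
    by_cases hm : m.degree = n
    · exact (h m hm).symm
    · have h1 : cf m f = 0 := not_not.1 fun h' => hm (hf m h')
      have h2 : cf m g = 0 := not_not.1 fun h' => hm (hgn m h')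
      rw [h1, h2]
  rwa [hfg]

end schurSpan

/-! ### Orbits of exponents under permutations of the variables. -/

section shape

/-- The multiset of the nonzero entries of an exponent. -/
def shape (m : ℕ →₀ ℕ) : Multiset ℕ := m.support.val.map m

theorem sum_shape (m : ℕ →₀ ℕ) : (shape m).sum = m.degree := rfl

/-- The nonzero entries of an exponent, as a partition. -/
def shapePartition (m : ℕ →₀ ℕ) : m.degree.Partition where
  parts := shape m
  parts_pos {i} hi := by
    rw [shape, Multiset.mem_map] at hi
    obtain ⟨v, hv, rfl⟩ := hi
    exact Nat.pos_of_ne_zero (Finsupp.mem_support_iff.1 hv)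
  parts_sum := sum_shape m

theorem shape_add_single {m : ℕ →₀ ℕ} {v a : ℕ} (hv : v ∉ m.support) (ha : a ≠ 0) :
    shape (Finsupp.single v a + m) = a ::ₘ shape m := by
  classical
  have h0 : m v = 0 := Finsupp.notMem_support_iff.1 hv
  have hsupp : (Finsupp.single v a + m).support = cons v m.support hv := by
    ext i
    rw [mem_cons, Finsupp.mem_support_iff, Finsupp.mem_support_iff, Finsupp.add_apply,
      Finsupp.single_apply]
    split_ifs with h
    · subst h
      simp [ha]
    · rw [zero_add, or_iff_right (Ne.symm h)]
  rw [shape, hsupp, cons_val, Multiset.map_cons, Finsupp.add_apply, Finsupp.single_eq_same, h0,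
    add_zero, shape]
  congr 1
  refine Multiset.map_congr rfl fun i hi => ?_
  have hne : i ≠ v := by
    rintro rfl
    exact hv hi
  rw [Finsupp.add_apply, Finsupp.single_eq_of_ne hne, zero_add]

theorem exists_shape_eq (s : Multiset ℕ) (hs : 0 ∉ s) : ∃ m, shape m = s := by
  induction s using Multiset.induction_on with
  | empty => exact ⟨0, rfl⟩
  | cons a s ih =>
    rw [Multiset.mem_cons, not_or] at hs
    obtain ⟨m, rfl⟩ := ih hs.2
    obtain ⟨v, hv⟩ := Infinite.exists_notMem_finset m.support
    exact ⟨_, shape_add_single hv (Ne.symm hs.1)⟩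

theorem card_fiber (m : ℕ →₀ ℕ) {c : ℕ} (hc : c ≠ 0) :
    Nat.card {i // m i = c} = (shape m).count c := by
  classical
  have h : ∀ i, i ∈ m.support.filter (fun i => m i = c) ↔ m i = c := by
    intro i
    rw [mem_filter, Finsupp.mem_support_iff]
    exact ⟨fun h => h.2, fun h => ⟨h ▸ hc, h⟩⟩
  rw [Nat.subtype_card _ h, shape, Multiset.count_map, card_def, filter_val]
  congr 1
  exact Multiset.filter_congr fun i _ => eq_comm

/-- A permutation is glued from bijections of the fibres. Over a nonzero value the fibres are
finite, counted by the shape; over `0` both are countably infinite. -/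
theorem exists_mapDomain_eq_of_shape_eq {m n : ℕ →₀ ℕ} (h : shape m = shape n) :
    ∃ e : ℕ ≃ ℕ, m.mapDomain e = n := by
  classical
  have hinf : ∀ k : ℕ →₀ ℕ, Infinite {i // k i = 0} := fun k => by
    rw [← Set.coe_ofPred, Set.infinite_coe_iff]
    refine (Set.Finite.infinite_compl k.support.finite_toSet).mono fun i hi => ?_
    simpa using hi
  have hfib : ∀ c, Nonempty ({i // m i = c} ≃ {i // n i = c}) := by
    intro c
    by_cases hc : c = 0
    · subst hc
      have := hinf m
      have := hinf n
      exact nonempty_equiv_of_countable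
    · have hfin : ∀ k : ℕ →₀ ℕ, Finite {i // k i = c} := fun k => by
        refine Set.Finite.subset k.support.finite_toSet fun i hi => ?_
        rw [mem_coe, Finsupp.mem_support_iff]
        exact fun h0 => hc (hi.symm.trans h0)
      have := hfin m
      have := hfin n
      refine (Finite.card_eq.1 ?_)
      rw [card_fiber m hc, card_fiber n hc, h]
  let e : ℕ ≃ ℕ := Equiv.ofFiberEquiv fun c => (hfib c).some
  refine ⟨e, ?_⟩
  ext i
  obtain ⟨j, rfl⟩ := e.surjective i
  rw [Finsupp.mapDomain_apply e.injective]
  exact (Equiv.ofFiberEquiv_map _ j).symm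

theorem shape_mapDomain (e : ℕ ≃ ℕ) (m : ℕ →₀ ℕ) : shape (m.mapDomain e) = shape m := by
  classical
  rw [shape, shape, Finsupp.mapDomain_support_of_injective e.injective, image_val_of_injOn e.injective.injOn,
    Multiset.map_map]
  exact Multiset.map_congr rfl fun i _ => Finsupp.mapDomain_apply e.injective _ _

end shape

/-! ### Uniqueness of the Schur expansion. -/

section kostka

/-- An exponent with the given parts as its nonzero entries. -/
noncomputable def exponentOf {n : ℕ} (mu : n.Partition) : ℕ →₀ ℕ :=
  (exists_shape_eq mu.parts fun h => lt_irrefl 0 (mu.parts_pos h)).choose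

theorem shape_exponentOf {n : ℕ} (mu : n.Partition) : shape (exponentOf mu) = mu.parts :=
  (exists_shape_eq mu.parts fun h => lt_irrefl 0 (mu.parts_pos h)).choose_spec

theorem degree_exponentOf {n : ℕ} (mu : n.Partition) : (exponentOf mu).degree = n := by
  rw [← sum_shape, shape_exponentOf, mu.parts_sum]

theorem coeff_eq_coeff_exponentOf {A : Type*} [CommRing A] {F : MvPowerSeries ℕ A}
    (hF : F ∈ SymSeries A) (m : ℕ →₀ ℕ) :
    MvPowerSeries.coeff m F = MvPowerSeries.coeff (exponentOf (shapePartition m)) F := by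
  obtain ⟨e, he⟩ := exists_mapDomain_eq_of_shape_eq (shape_exponentOf (shapePartition m)).symm
  rw [← he, hF]

/-- The monomial symmetric function of a partition. -/
noncomputable def monoSymm {n : ℕ} (mu : n.Partition) : SymFun :=
  SymFun.ofCoeff (fun m => if shape m = mu.parts then 1 else 0) n
    (fun e m => by rw [shape_mapDomain])
    (fun m hm => by
      by_contra hlt
      refine hm (if_neg fun h => hlt ?_)
      rw [← sum_shape, h, mu.parts_sum])

theorem cf_monoSymm {n : ℕ} (mu : n.Partition) (m : ℕ →₀ ℕ) :
    cf m (monoSymm mu) = if shape m = mu.parts then 1 else 0 := rfl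

theorem isHomog_monoSymm {n : ℕ} (mu : n.Partition) : IsHomog n (monoSymm mu) := by
  intro m hm
  rw [cf_monoSymm] at hm
  by_contra hne
  refine hm (if_neg fun h => hne ?_)
  rw [← sum_shape, h, mu.parts_sum]

/-- The matrix of the coefficients of the Schur functions of degree `n`. -/
noncomputable def kostka (n : ℕ) : Matrix n.Partition n.Partition ℤ :=
  Matrix.of fun lam mu => cf (exponentOf mu) (schur lam)

/-- The rows of `D` expand the monomial symmetric functions in Schur functions; comparing
coefficients at the representative exponents gives the identity. A left inverse suffices because the
matrix is square. -/
theorem exists_mul_kostka_eq_one (n : ℕ) :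
    ∃ D : Matrix n.Partition n.Partition ℤ, D * kostka n = 1 := by
  have h : ∀ mu : n.Partition, ∃ c : n.Partition → ℤ, ∑ lam, c lam • schur lam = monoSymm mu :=
    fun mu => (Submodule.mem_span_range_iff_exists_fun ℤ).1 (mem_span_schur (isHomog_monoSymm mu))
  choose D hD using h
  refine ⟨Matrix.of D, ?_⟩
  ext mu nu
  have h2 := congrArg (cfHom (exponentOf nu)) (hD mu)
  rw [map_sum, cfHom_apply, cf_monoSymm, shape_exponentOf] at h2
  rw [Matrix.mul_apply, Matrix.one_apply]
  have h3 : (if nu.parts = mu.parts then (1 : ℤ) else 0) = if mu = nu then 1 else 0 := by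
    congr 1
    rw [← Nat.Partition.ext_iff]
    exact propext eq_comm
  rw [← h3, ← h2]
  exact sum_congr rfl fun lam _ => (map_zsmul (cfHom (exponentOf nu)) _ _).symm

/-- The inverse of the matrix of the coefficients of the Schur functions of degree `n`. -/
noncomputable def kostkaInv (n : ℕ) : Matrix n.Partition n.Partition ℤ :=
  (exists_mul_kostka_eq_one n).choose

theorem kostkaInv_mul_kostka (n : ℕ) : kostkaInv n * kostka n = 1 :=
  (exists_mul_kostka_eq_one n).choose_spec

theorem kostka_mul_kostkaInv (n : ℕ) : kostka n * kostkaInv n = 1 :=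
  mul_eq_one_comm.1 (kostkaInv_mul_kostka n)

variable {A : Type*} [CommRing A]

/-- Invertibility over `ℤ` persists over every commutative ring, so torsion in `A` does no harm. -/
theorem vecMul_kostka_eq_iff {n : ℕ} (y f : n.Partition → A) :
    (∀ mu, ∑ lam, kostka n lam mu • y lam = f mu) ↔
      y = fun lam => ∑ mu, kostkaInv n mu lam • f mu := by
  have hK : ∀ (M : Matrix n.Partition n.Partition ℤ) (v : n.Partition → A) (mu : n.Partition),
      ∑ lam, M lam mu • v lam = Matrix.vecMul v (M.map (Int.castRingHom A)) mu := by
    intro M v mu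
    refine sum_congr rfl fun lam _ => ?_
    rw [zsmul_eq_mul, mul_comm]
    rfl
  have h1 := congrArg (fun M => M.map (Int.castRingHom A)) (kostkaInv_mul_kostka n)
  have h2 := congrArg (fun M => M.map (Int.castRingHom A)) (kostka_mul_kostkaInv n)
  simp only [Matrix.map_mul, Matrix.map_one, map_zero, map_one] at h1 h2
  simp only [hK]
  rw [← funext_iff]
  constructor
  · rintro rfl
    rw [Matrix.vecMul_vecMul, h2, Matrix.vecMul_one]
  · intro h
    have hy : y = Matrix.vecMul f ((kostkaInv n).map (Int.castRingHom A)) := h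
    rw [hy, Matrix.vecMul_vecMul, h1, Matrix.vecMul_one]

theorem coeff_schurSum (y : (n : ℕ) → n.Partition → A) {N : ℕ} {m : ℕ →₀ ℕ} {n : ℕ}
    (hm : m.degree = n) (hN : n < N) :
    MvPowerSeries.coeff m (schurSum y N) =
      ∑ lam : n.Partition, cf m (schur lam) • y n lam := by
  rw [schurSum, map_sum, sum_eq_single n]
  · rw [map_sum]
    exact sum_congr rfl fun lam _ => coeff_tmul _ _ _
  · intro k _ hk
    rw [map_sum]
    refine sum_eq_zero fun lam _ => ?_
    rw [coeff_tmul]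
    have h0 : cf m (schur lam) = 0 := by
      by_contra h
      exact hk ((schur_mem_homogSubmodule lam m h).symm.trans hm)
    exact (congrArg (· • y k lam) h0).trans (zero_smul ℤ _)
  · intro h
    exact absurd (mem_range.2 hN) h

/-- A symmetric series is a combination of the Schur functions in a unique way. -/
theorem convergesTo_schurSum_iff {F : MvPowerSeries ℕ A} (hF : F ∈ SymSeries A)
    (y : (n : ℕ) → n.Partition → A) :
    ConvergesTo (schurSum y) F ↔
      y = fun n lam => ∑ mu, kostkaInv n mu lam • MvPowerSeries.coeff (exponentOf mu) F := by
  have h1 : ConvergesTo (schurSum y) F ↔ ∀ n (mu : n.Partition),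
      ∑ lam, kostka n lam mu • y n lam = MvPowerSeries.coeff (exponentOf mu) F := by
    constructor
    · intro h n mu
      obtain ⟨N, hN⟩ := h (n + 1)
      -- The partial sum must be beyond the convergence bound and also already contain degree `n`.
      have h2 := hN (max N (n + 1)) (le_max_left _ _) (exponentOf mu)
        (by rw [degree_exponentOf]; omega)
      rw [map_sub, sub_eq_zero, coeff_schurSum y (degree_exponentOf mu)
        (lt_of_lt_of_le (Nat.lt_succ_self n) (le_max_right _ _))] at h2
      exact h2
    · intro h n
      refine ⟨n, fun N hN m hm => ?_⟩
      rw [map_sub, sub_eq_zero, coeff_schurSum y rfl (hm.trans_le hN),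
        coeff_eq_coeff_exponentOf hF m, ← h]
      refine sum_congr rfl fun lam _ => congrArg (· • _) ?_
      exact coeff_eq_coeff_exponentOf (schur lam).1.2 m
  rw [h1, funext_iff]
  exact forall_congr' fun n => vecMul_kostka_eq_iff (y n) _

end kostka

/-! ### The universal symmetric functions `φ_λ`. -/

section universal
variable {R : Type*} [CommRing R] [PreLambdaRing R]

/-- `a ↦ σ_t(a)` as a homomorphism from the additive group to the units. -/
noncomputable def sigmaUnit (R : Type*) [CommRing R] [PreLambdaRing R] :
    Multiplicative R →* (PowerSeries R)ˣ :=
  MonoidHom.toHomUnits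
    { toFun := fun a => sigmaGen a.toAdd
      map_one' := by
        ext n
        rw [sigmaGen, PowerSeries.coeff_mk, PowerSeries.coeff_one, toAdd_one]
        split_ifs with h
        · rw [h, PreLambdaRing.σ_zero]
        · rw [PreLambdaRing.σ_zero_right h]
      map_mul' := fun a b => sigmaGen_add a.toAdd b.toAdd }

theorem isUnit_mk_hSymm : IsUnit (PowerSeries.mk hSymm) := by
  rw [PowerSeries.isUnit_iff_constantCoeff, ← PowerSeries.coeff_zero_eq_constantCoeff_apply,
    PowerSeries.coeff_mk, hSymm_zero]
  exact isUnit_one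

/-- The symmetric function that sends `x` to `σⱼ(c x)`, the coefficient of `t^j` in
`(∑ₙ hₙ t^n)^c`. -/
noncomputable def sigmaMul (j : ℕ) (c : ℤ) : SymFun :=
  PowerSeries.coeff j (isUnit_mk_hSymm.unit ^ c : (PowerSeries SymFun)ˣ).1

/-- Coefficientwise, `f ↦ f ∘ x` takes `∑ hₙ t^n` to `σ_t(x)`, hence its power `c` to `σ_t(x)^c =
σ_t(c x)`. Working in unit groups covers negative `c`. -/
theorem circ_sigmaMul (j : ℕ) (c : ℤ) (x : R) :
    circ (sigmaMul j c) x = PreLambdaRing.σ j (c • x) := by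
  have h1 : Units.map (PowerSeries.map (circHom x)).toMonoidHom isUnit_mk_hSymm.unit =
      sigmaUnit R (Multiplicative.ofAdd x) := by
    refine Units.ext ?_
    change PowerSeries.map (circHom x) (PowerSeries.mk hSymm) = sigmaGen x
    ext n
    rw [PowerSeries.coeff_map, PowerSeries.coeff_mk, circHom_apply, circ_hSymm, sigmaGen,
      PowerSeries.coeff_mk]
  have h2 : Units.map (PowerSeries.map (circHom x)).toMonoidHom (isUnit_mk_hSymm.unit ^ c) =
      sigmaUnit R (Multiplicative.ofAdd (c • x)) := by
    rw [map_zpow, h1, ofAdd_zsmul, map_zpow]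
  have h3 := congrArg (fun u : (PowerSeries R)ˣ => PowerSeries.coeff j u.1) h2
  have h4 : PowerSeries.coeff j (sigmaGen (c • x)) = PreLambdaRing.σ j (c • x) :=
    PowerSeries.coeff_mk _ _
  exact (PowerSeries.coeff_map (circHom x) j _).symm.trans (h3.trans h4)

/-- The symmetric function that sends `x` to the coefficient of `x^M` in `Exp(F x)`. -/
noncomputable def expOp (F : MvPowerSeries ℕ ℤ) (M : ℕ →₀ ℕ) : SymFun :=
  ∑ n ∈ range (M.degree + 1), ∑ k ∈ weights n M,
    k.prod fun m j => sigmaMul j (MvPowerSeries.coeff m F)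

/-- The coefficient is a polynomial in the `σⱼ(cₘ x)` with integers `cₘ`, each of which is a
universal operation on `x`. -/
theorem circ_expOp (F : SymSeries ℤ) (M : ℕ →₀ ℕ) (x : R) :
    circ (expOp F.1 M) x = MvPowerSeries.coeff M (expSeries (tmul F x).1) := by
  change circHom x _ = ∑ n ∈ range (M.degree + 1), MvPowerSeries.coeff M
    (sigmaSeries n (tmul F x).1)
  rw [expOp, map_sum]
  refine sum_congr rfl fun n _ => ?_
  rw [map_sum, coeff_sigmaSeries]
  refine sum_congr rfl fun k _ => ?_
  rw [Finsupp.prod, map_prod]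
  refine prod_congr rfl fun m _ => ?_
  simp only [circHom_apply, circ_sigmaMul, coeff_tmul]

/-- The symmetric function `φ_λ`, the coefficient of `s_λ` in `Exp(Log(1 + p₁) x)`. -/
noncomputable def phi (n : ℕ) (lam : n.Partition) : SymFun :=
  ∑ mu, kostkaInv n mu lam • expOp logP.1 (exponentOf mu)

theorem circ_phi {n : ℕ} (lam : n.Partition) (x : R) :
    circ (phi n lam) x = ∑ mu, kostkaInv n mu lam •
      MvPowerSeries.coeff (exponentOf mu) (Exp (tmul logP x)).1 := by
  rw [← circHom_apply, phi, map_sum]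
  refine sum_congr rfl fun mu _ => ?_
  rw [map_zsmul, circHom_apply, circ_expOp, coe_Exp (tmul_logP_mem_filtration x)]

theorem toRat_mem_symSeries {R : Type*} [CommRing R] (F : SymSeries R) :
    toRat F ∈ SymSeries (TensorProduct ℤ ℚ R) := by
  intro e m
  rw [toRat, MvPowerSeries.coeff_map, MvPowerSeries.coeff_map, F.2]

end universal

end LambdaRings

/-! ### The theorem. -/

theorem mainTheorem4 :
    ((Log (1 + (pSum 1).1) : SymSeries ℤ).1 ∈ filtration ℤ 1 ∧
      Exp (Log (1 + (pSum 1).1) : SymSeries ℤ) = 1 + (pSum 1).1 ∧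
      ConvergesTo
        (fun N => ∑ n ∈ Finset.Icc 1 N,
          MvPowerSeries.C ((ArithmeticFunction.moebius n : ℚ) / (n : ℚ)) * logOneAdd (pIn ℚ n))
        (MvPowerSeries.map (Int.castRingHom ℚ) (Log (1 + (pSum 1).1) : SymSeries ℤ).1)) ∧
    ∃ φ : (n : ℕ) → n.Partition → SymFun,
      ∀ (R : Type*) [CommRing R] [LambdaRing R] (x : R),
        ConvergesTo (phiProd x) (toRat (Exp (tmul (Log (1 + (pSum 1).1)) x))) ∧
        (∀ y : (n : ℕ) → n.Partition → R,
          ConvergesTo (schurSum y) (Exp (tmul (Log (1 + (pSum 1).1)) x)).1 ↔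
            y = fun n lam => circ (φ n lam) x) ∧
        (∀ y : (n : ℕ) → n.Partition → TensorProduct ℤ ℚ R,
          ConvergesTo (schurSum y) (toRat (Exp (tmul (Log (1 + (pSum 1).1)) x))) ↔
            y = fun n lam => TensorProduct.tmul ℤ (1 : ℚ) (circ (φ n lam) x)) := by
  refine ⟨⟨logP_mem_filtration, Exp_logP, convergesTo_logP⟩, phi, fun R _ _ x =>
    ⟨convergesTo_phiProd x, fun y => ?_, fun y => ?_⟩⟩
  · rw [convergesTo_schurSum_iff (Exp (tmul logP x)).2]
    simp only [circ_phi]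
  -- The same integral inverse matrix gives the expansion over `ℚ ⊗ R`, and `r ↦ 1 ⊗ r` commutes
  -- with integral combinations.
  · rw [convergesTo_schurSum_iff (toRat_mem_symSeries _)]
    have h : ∀ (n : ℕ) (lam : n.Partition),
        ∑ mu, kostkaInv n mu lam •
          MvPowerSeries.coeff (exponentOf mu) (toRat (Exp (tmul logP x))) =
        TensorProduct.tmul ℤ (1 : ℚ) (circ (phi n lam) x) := by
      intro n lam
      rw [circ_phi, TensorProduct.tmul_sum]
      refine Finset.sum_congr rfl fun mu _ => ?_
      rw [toRat, MvPowerSeries.coeff_map, TensorProduct.tmul_smul]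
      rfl
    simp only [h]
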